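/- Let $n\ge 1$ and $m$ be integers with $n-1\le m\le\binom n2$, and let $\mathcal G(n,m)$ be the (non-empty) set of connected simple graphs with $n$ vertices and $m$ edges. Regard each $G\in\mathcal G(n,m)$ as a geodesic metric space whose points are the vertices and all interior points of the edges, every edge being isometric to $[0,1]$, with the shortest path distance. A geodesic triangle $T$ in $G$ is the union of three geodesics $[x_1x_2]$, $[x_2x_3]$, $[x_3x_1]$, where $x_1,x_2,x_3$ are arbitrary points of $G$; let $\delta(T)$ be the infimum of all $\delta\ge 0$ such that every point of each side of $T$ is at distance at most $\delta$ from the union of the other two sides, and let $\delta(G)=\sup_T\delta(T)$ over all geodesic triangles $T$ in $G$. Put $$A(n,m)=\min\{\delta(G) : G\in\mathcal G(n,m)\}.$$ Then the minimum exists and: - if $m=n-1$, then $A(n,m)=0$; - if $m\ge n$ and $2m\le 3n-3$, then $A(n,m)=3/4$; - if $m\ge n$ and $2m>3n-3$, then $A(n,m)=1$. -/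

import Mathlib

open scoped ENNReal

/-! ### Gromov hyperbolicity of metric spaces (Rips condition) -/

namespace GromovHyp

/-- `S` is (the image of) a geodesic `[xy]` joining `x` to `y`: the image of a curve
`γ : [a, b] → X` with `d (γ t) (γ s) = |t - s|` on `[a, b]`, `γ a = x` and `γ b = y`
(the length of each `γ|[t, s]` is then `|t - s|` too). -/
def IsGeodesicSegment {X : Type*} [MetricSpace X] (S : Set X) (x y : X) : Prop :=
  ∃ (a b : ℝ) (γ : ℝ → X), a ≤ b ∧ γ a = x ∧ γ b = y ∧
    (∀ s ∈ Set.Icc a b, ∀ t ∈ Set.Icc a b, dist (γ s) (γ t) = |s - t|) ∧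
    S = γ '' Set.Icc a b

/-- The triangle with sides `A`, `B`, `C` is `δ`-thin: every point of a side is at distance at
most `δ` from the union of the two other sides. -/
def IsThin {X : Type*} [MetricSpace X] (δ : ℝ≥0∞) (A B C : Set X) : Prop :=
  (∀ p ∈ A, Metric.infEDist p (B ∪ C) ≤ δ) ∧
  (∀ p ∈ B, Metric.infEDist p (A ∪ C) ≤ δ) ∧
  (∀ p ∈ C, Metric.infEDist p (A ∪ B) ≤ δ)

/-- The sharp thin constant `δ(T)` of the triangle with sides `A`, `B`, `C`. -/
noncomputable def thinConst {X : Type*} [MetricSpace X] (A B C : Set X) : ℝ≥0∞ :=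
  sInf {δ : ℝ≥0∞ | IsThin δ A B C}

/-- The sharp hyperbolicity constant `δ(X)`: the supremum of `δ(T)` over all geodesic triangles
`T = {x, y, z}` of `X`. -/
noncomputable def hyperbolicityConst (X : Type*) [MetricSpace X] : ℝ≥0∞ :=
  sSup {r : ℝ≥0∞ | ∃ (x y z : X) (A B C : Set X),
    IsGeodesicSegment A x y ∧ IsGeodesicSegment B y z ∧ IsGeodesicSegment C z x ∧
    r = thinConst A B C}

/-! ### A connected simple graph as a geodesic metric space with edges of length one -/

/-- The points of a graph (its vertices and the interior points of its edges) in barycentric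
coordinates: the vertex `u` is the point with coordinate `1` at `u` and `0` elsewhere, and the
point at distance `t ∈ [0, 1]` from `u` on the edge `[u, v]` has coordinates `1 - t` at `u`,
`t` at `v` and `0` elsewhere. -/
@[ext]
structure MetricGraph {V : Type*} [Fintype V] (G : SimpleGraph V) (_hG : G.Connected) where
  coord : V → ℝ
  nonneg : ∀ w, 0 ≤ coord w
  sum_eq_one : ∑ w, coord w = 1
  supp : ∃ u v, (u = v ∨ G.Adj u v) ∧ ∀ w, coord w ≠ 0 → w = u ∨ w = v

namespace MetricGraph

variable {V : Type*} [Fintype V] {G : SimpleGraph V} {hG : G.Connected}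

/-- `x` and `y` lie on a common closed edge (or are the same vertex). -/
def SameEdge (x y : MetricGraph G hG) : Prop :=
  ∃ u v, (u = v ∨ G.Adj u v) ∧ (∀ w, x.coord w ≠ 0 → w = u ∨ w = v) ∧
    ∀ w, y.coord w ≠ 0 → w = u ∨ w = v

open Classical in
/-- The length of a shortest path from `x` to `y`. On a common closed edge `[u, v]` it is the
distance inside that edge, `|x_u - y_u| = |x_v - y_v|`, that is, the sup distance of the
coordinates. Otherwise a path leaves the edge of `x` through an endpoint `u`, at distance
`1 - x_u` from `x`, enters the edge of `y` through an endpoint `v`, at distance `1 - y_v` from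
`y`, and has length at least `d(u, v)` in between. -/
noncomputable def pathDist (x y : MetricGraph G hG) : ℝ :=
  if SameEdge x y then dist x.coord y.coord
  else ⨅ p : {u : V // x.coord u ≠ 0} × {v : V // y.coord v ≠ 0},
    (1 - x.coord p.1) + (G.dist p.1 p.2 : ℝ) + (1 - y.coord p.2)

theorem sameEdge_symm {x y : MetricGraph G hG} (h : SameEdge x y) : SameEdge y x := by
  obtain ⟨u, v, h1, h2, h3⟩ := h
  exact ⟨u, v, h1, h3, h2⟩

theorem coord_le_one (x : MetricGraph G hG) (u : V) : x.coord u ≤ 1 := by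
  rw [← x.sum_eq_one]
  exact Finset.single_le_sum (fun w _ => x.nonneg w) (Finset.mem_univ u)

theorem exists_ne (x : MetricGraph G hG) : ∃ u, x.coord u ≠ 0 := by
  by_contra! h
  have := x.sum_eq_one
  simp [h] at this

instance (x : MetricGraph G hG) : Nonempty {u : V // x.coord u ≠ 0} :=
  let ⟨u, hu⟩ := x.exists_ne
  ⟨⟨u, hu⟩⟩

theorem add_eq_one (x : MetricGraph G hG) {u v : V} (huv : u ≠ v)
    (h : ∀ w, x.coord w ≠ 0 → w = u ∨ w = v) : x.coord u + x.coord v = 1 := by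
  classical
  rw [← x.sum_eq_one, ← Finset.sum_pair huv]
  refine Finset.sum_subset (Finset.subset_univ _) fun w _ hw => ?_
  by_contra h0
  exact hw (by simpa using h w h0)

theorem add_le_one (x : MetricGraph G hG) {u v : V} (huv : u ≠ v) :
    x.coord u + x.coord v ≤ 1 := by
  classical
  rw [← x.sum_eq_one, ← Finset.sum_pair huv]
  exact Finset.sum_le_sum_of_subset_of_nonneg (Finset.subset_univ _) fun w _ _ => x.nonneg w

theorem eq_one (x : MetricGraph G hG) {u : V}
    (h : ∀ w, x.coord w ≠ 0 → w = u) : x.coord u = 1 := by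
  rw [← x.sum_eq_one]
  refine (Finset.sum_eq_single u (fun w _ hw => ?_) (by simp)).symm
  by_contra h0
  exact hw (h w h0)

/-- Two points of the support of `y` are the endpoints of the edge of `y`. -/
theorem dist_supp (y : MetricGraph G hG) {v v' : V} (hv : y.coord v ≠ 0)
    (hv' : y.coord v' ≠ 0) : (G.dist v v' : ℝ) ≤ (1 - y.coord v) + (1 - y.coord v') := by
  by_cases h : v = v'
  · subst h
    have := y.coord_le_one v
    simp
    linarith
  · obtain ⟨a, b, hab, hs⟩ := y.supp
    have hadj : G.Adj v v' := by
      rcases hs v hv with rfl | rfl <;> rcases hs v' hv' with rfl | rfl <;>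
        first
        | exact absurd rfl h
        | (rcases hab with hab | hab
           · first | exact absurd hab h | exact absurd hab.symm h
           · first | exact hab | exact hab.symm)
    rw [SimpleGraph.dist_eq_one_iff_adj.2 hadj]
    have := y.add_le_one h
    push_cast
    linarith

theorem coord_dist_le (x y : MetricGraph G hG) {u v : V} :
    dist x.coord y.coord ≤ (1 - x.coord u) + (G.dist u v : ℝ) + (1 - y.coord v) := by
  have h1 := x.coord_le_one u
  have h2 := y.coord_le_one v
  have h3 : (0 : ℝ) ≤ G.dist u v := Nat.cast_nonneg _
  refine (dist_pi_le_iff (by linarith)).2 fun w => ?_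
  have hx0 := x.nonneg w
  have hy0 := y.nonneg w
  have hx1 := x.coord_le_one w
  have hy1 := y.coord_le_one w
  rw [Real.dist_eq, abs_le]
  by_cases huv : u = v
  · subst huv
    by_cases hw : w = u
    · subst hw
      constructor <;> linarith
    · have := x.add_le_one hw
      have := y.add_le_one hw
      constructor <;> linarith
  · have h4 : (1 : ℝ) ≤ G.dist u v := by
      exact_mod_cast hG.pos_dist_of_ne huv
    constructor <;> linarith

theorem pathDist_le (x y : MetricGraph G hG) {u v : V} (hu : x.coord u ≠ 0)
    (hv : y.coord v ≠ 0) :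
    pathDist x y ≤ (1 - x.coord u) + (G.dist u v : ℝ) + (1 - y.coord v) := by
  unfold pathDist
  split_ifs with h
  · exact coord_dist_le x y
  · exact ciInf_le (f := fun p : {u : V // x.coord u ≠ 0} × {v : V // y.coord v ≠ 0} =>
      (1 - x.coord p.1) + (G.dist p.1 p.2 : ℝ) + (1 - y.coord p.2))
      (Set.finite_range _).bddBelow (⟨u, hu⟩, ⟨v, hv⟩)

theorem pathDist_same {x y : MetricGraph G hG} (h : SameEdge x y) :
    pathDist x y = dist x.coord y.coord := by
  simp [pathDist, h]

theorem pathDist_exists {x y : MetricGraph G hG} (h : ¬ SameEdge x y) :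
    ∃ u v, x.coord u ≠ 0 ∧ y.coord v ≠ 0 ∧
      pathDist x y = (1 - x.coord u) + (G.dist u v : ℝ) + (1 - y.coord v) := by
  obtain ⟨p, hp⟩ := exists_eq_ciInf_of_finite
    (f := fun p : {u : V // x.coord u ≠ 0} × {v : V // y.coord v ≠ 0} =>
      (1 - x.coord p.1) + (G.dist p.1 p.2 : ℝ) + (1 - y.coord p.2))
  refine ⟨p.1, p.2, p.1.2, p.2.2, ?_⟩
  rw [pathDist, if_neg h]
  exact hp.symm

theorem coord_dist_le_pathDist (x y : MetricGraph G hG) :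
    dist x.coord y.coord ≤ pathDist x y := by
  by_cases h : SameEdge x y
  · exact (pathDist_same h).ge
  · obtain ⟨u, v, _, _, e⟩ := pathDist_exists h
    exact e ▸ coord_dist_le x y

theorem pathDist_comm_le (x y : MetricGraph G hG) : pathDist x y ≤ pathDist y x := by
  by_cases h : SameEdge x y
  · rw [pathDist_same h, pathDist_same (sameEdge_symm h), dist_comm]
  · obtain ⟨u, v, hu, hv, e⟩ := pathDist_exists (fun h' => h (sameEdge_symm h') : ¬ SameEdge y x)
    have := pathDist_le x y hv hu
    rw [SimpleGraph.dist_comm] at this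
    linarith

theorem move {x y : MetricGraph G hG} (h : SameEdge x y) {v : V} (hv : y.coord v ≠ 0) :
    ∃ u, x.coord u ≠ 0 ∧
      (1 - x.coord u) + (G.dist u v : ℝ) ≤ dist x.coord y.coord + (1 - y.coord v) := by
  obtain ⟨b, hb, hxb⟩ : ∃ b, (v = b ∨ G.Adj v b) ∧ ∀ w, x.coord w ≠ 0 → w = v ∨ w = b := by
    obtain ⟨a, b, hab, hx, hy⟩ := h
    rcases hy v hv with rfl | rfl
    · exact ⟨b, hab, hx⟩
    · exact ⟨a, hab.imp Eq.symm SimpleGraph.Adj.symm, fun w hw => (hx w hw).symm⟩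
  have hd := dist_le_pi_dist x.coord y.coord v
  rw [Real.dist_eq, abs_sub_comm] at hd
  by_cases hxv : x.coord v = 0
  · have hne : v ≠ b := by
      rintro rfl
      have := x.eq_one (u := v) fun w hw => (hxb w hw).elim id id
      linarith
    have hadj := hb.resolve_left hne
    have h1 := x.add_eq_one hne hxb
    refine ⟨b, by intro h0; linarith, ?_⟩
    rw [SimpleGraph.dist_eq_one_iff_adj.2 hadj.symm]
    have := le_abs_self (y.coord v - x.coord v)
    push_cast
    linarith
  · refine ⟨v, hxv, ?_⟩
    have := le_abs_self (y.coord v - x.coord v)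
    simp
    linarith

theorem sameEdge_of_mid {x y z : MetricGraph G hG} (hxy : SameEdge x y) (hyz : SameEdge y z)
    {v v' : V} (hvv : v ≠ v') (hv : y.coord v ≠ 0) (hv' : y.coord v' ≠ 0) : SameEdge x z := by
  obtain ⟨a, b, hab, h1, h2⟩ := hxy
  obtain ⟨c, d, _, h3, h4⟩ := hyz
  refine ⟨a, b, hab, h1, fun w hw => ?_⟩
  have e1 := h2 v hv
  have e2 := h2 v' hv'
  have e3 := h3 v hv
  have e4 := h3 v' hv'
  have e5 := h4 w hw
  grind

theorem pathDist_triangle (x y z : MetricGraph G hG) :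
    pathDist x z ≤ pathDist x y + pathDist y z := by
  by_cases hxy : SameEdge x y <;> by_cases hyz : SameEdge y z
  · by_cases hxz : SameEdge x z
    · rw [pathDist_same hxy, pathDist_same hyz, pathDist_same hxz]
      exact dist_triangle _ _ _
    · obtain ⟨v, hv⟩ := y.exists_ne
      have h1 : y.coord v = 1 := y.eq_one fun w hw => by
        by_contra hne
        exact hxz (sameEdge_of_mid hxy hyz hne hw hv)
      obtain ⟨u, hu, e1⟩ := move hxy hv
      obtain ⟨w, hw, e2⟩ := move (sameEdge_symm hyz) hv
      have e3 := pathDist_le x z hu hw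
      have e4 : (G.dist u w : ℝ) ≤ G.dist u v + G.dist v w := by
        exact_mod_cast hG.dist_triangle
      rw [pathDist_same hxy, pathDist_same hyz, dist_comm y.coord]
      rw [SimpleGraph.dist_comm] at e2
      linarith
  · obtain ⟨v, w, hv, hw, e⟩ := pathDist_exists hyz
    obtain ⟨u, hu, e1⟩ := move hxy hv
    have e3 := pathDist_le x z hu hw
    have e4 : (G.dist u w : ℝ) ≤ G.dist u v + G.dist v w := by
      exact_mod_cast hG.dist_triangle
    rw [pathDist_same hxy, e]
    linarith
  · obtain ⟨u, v, hu, hv, e⟩ := pathDist_exists hxy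
    obtain ⟨w, hw, e1⟩ := move (sameEdge_symm hyz) hv
    have e3 := pathDist_le x z hu hw
    have e4 : (G.dist u w : ℝ) ≤ G.dist u v + G.dist v w := by
      exact_mod_cast hG.dist_triangle
    rw [pathDist_same hyz, e, dist_comm y.coord]
    rw [SimpleGraph.dist_comm] at e1
    linarith
  · obtain ⟨u, v, hu, hv, e⟩ := pathDist_exists hxy
    obtain ⟨v', w, hv', hw, e'⟩ := pathDist_exists hyz
    have e1 := y.dist_supp hv hv'
    have e3 := pathDist_le x z hu hw
    have e4 : (G.dist u w : ℝ) ≤ G.dist u v + G.dist v w := by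
      exact_mod_cast hG.dist_triangle
    have e5 : (G.dist v w : ℝ) ≤ G.dist v v' + G.dist v' w := by
      exact_mod_cast hG.dist_triangle
    linarith

/-- A connected graph as a metric space, with the shortest path distance. -/
noncomputable instance : MetricSpace (MetricGraph G hG) where
  dist := pathDist
  dist_self x := by
    have h : SameEdge x x := by
      obtain ⟨u, v, h1, h2⟩ := x.supp
      exact ⟨u, v, h1, h2, h2⟩
    exact (pathDist_same h).trans (dist_self _)
  dist_comm x y := le_antisymm (pathDist_comm_le x y) (pathDist_comm_le y x)
  dist_triangle := pathDist_triangle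
  eq_of_dist_eq_zero {x y} h := by
    refine MetricGraph.ext (dist_le_zero.1 ?_)
    exact (coord_dist_le_pathDist x y).trans (le_of_eq h)

end MetricGraph

/-- The set `{δ(G) : G ∈ 𝒢(n, m)}` of the hyperbolicity constants of the connected simple graphs
with `n` vertices and `m` edges, all of length one (up to isomorphism, the vertex set is
`Fin n`). Its least element is `A(n, m)`. -/
def hyperbolicityConstants (n m : ℕ) : Set ℝ≥0∞ :=
  {r | ∃ (G : SimpleGraph (Fin n)) (hG : G.Connected), G.edgeSet.ncard = m ∧
    r = hyperbolicityConst (MetricGraph G hG)}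

end GromovHyp

/-!
All bounds come from comparing distances; no cycle of the graph has to be chosen.

Lower bounds. If two geodesics have the same endpoints and one of them passes through a vertex `a`
whose open star the other one avoids, then `a` is at distance at least one from the other geodesic,
so that the hyperbolicity constant is at least one (`one_le_of_bigon`). Fix a root `r` and sort the
vertices into levels by their distance to `r`. If the constant is less than one, then every vertex
other than `r` has exactly one neighbour in the level below, its parent
(`one_le_of_two_parents`), and adjacent vertices of the same level have the same parent
(`one_le_of_level_edge`). A vertex has at most one neighbour in its own level: otherwise two such
neighbours and the common parent give either a bigon between vertices at distance two or a complete
graph on four vertices, whose constant is one (`one_le_of_complete_four`). Hence a graph with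
constant less than one has `n - 1` edges between levels and at most `(n - 1) / 2` inside levels. If
there is an edge inside a level, then there is a triangle and the constant is at least `3 / 4`.

Upper bounds. Let the vertex `c` be adjacent to all others. It cuts the graph into branches, and
the constant is at most half of the largest diameter of a branch together with `c`
(`hyperbolicityConst_le_of_cutsOff`, `hyperbolicityConst_le_of_universal`). With branches that
are triangles or edges (`windmill`) the diameter is at most `3 / 2`, and all numbers of edges
between `n - 1` and `3 (n - 1) / 2` occur. In the star all points are cut points, and its constant
is zero. A complete multipartite graph has diameter at most two; with parts of at most three
vertices, one of them `{c}`, and pendant edges at `c` (`multipartite`) all numbers of edges from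
`n` to `n.choose 2` occur (`exists_multipartite_parameters`).
-/

namespace GromovHyp

/-! ### Geodesics and thin triangles in metric spaces -/

section Metric

variable {X : Type*} [MetricSpace X]

theorem IsGeodesicSegment.symm {S : Set X} {x y : X} (h : IsGeodesicSegment S x y) :
    IsGeodesicSegment S y x := by
  obtain ⟨a, b, γ, hab, rfl, rfl, hd, rfl⟩ := h
  refine ⟨-b, -a, fun t => γ (-t), by linarith, by simp, by simp, ?_, ?_⟩
  · intro s hs t ht
    rw [hd (-s) ⟨by linarith [hs.2], by linarith [hs.1]⟩ (-t)
      ⟨by linarith [ht.2], by linarith [ht.1]⟩, abs_sub_comm]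
    congr 1
    ring
  · ext q
    constructor
    · rintro ⟨t, ht, rfl⟩
      exact ⟨-t, ⟨by linarith [ht.2], by linarith [ht.1]⟩, by simp⟩
    · rintro ⟨t, ht, rfl⟩
      exact ⟨-t, ⟨by linarith [ht.2], by linarith [ht.1]⟩, rfl⟩

theorem IsGeodesicSegment.left_mem {S : Set X} {x y : X} (h : IsGeodesicSegment S x y) :
    x ∈ S := by
  obtain ⟨a, b, γ, hab, rfl, rfl, -, rfl⟩ := h
  exact ⟨a, Set.left_mem_Icc.2 hab, rfl⟩

theorem IsGeodesicSegment.right_mem {S : Set X} {x y : X} (h : IsGeodesicSegment S x y) :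
    y ∈ S :=
  h.symm.left_mem

theorem IsGeodesicSegment.refl (x : X) : IsGeodesicSegment {x} x x :=
  ⟨0, 0, fun _ => x, le_rfl, rfl, rfl, by
    intro s hs t ht
    obtain rfl : s = 0 := le_antisymm hs.2 hs.1
    obtain rfl : t = 0 := le_antisymm ht.2 ht.1
    simp, by simp⟩

theorem IsGeodesicSegment.dist_add_dist {S : Set X} {x y p : X} (h : IsGeodesicSegment S x y)
    (hp : p ∈ S) : dist x p + dist p y = dist x y := by
  obtain ⟨a, b, γ, hab, rfl, rfl, hd, rfl⟩ := h
  obtain ⟨t, ht, rfl⟩ := hp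
  have ha := Set.left_mem_Icc.2 hab
  have hb := Set.right_mem_Icc.2 hab
  rw [hd a ha t ht, hd t ht b hb, hd a ha b hb, abs_of_nonpos (by linarith [ht.1]),
    abs_of_nonpos (by linarith [ht.2]), abs_of_nonpos (by linarith)]
  ring

/-- Two geodesics may be concatenated as soon as the length of the result is the distance of
its endpoints. -/
theorem IsGeodesicSegment.trans {S T : Set X} {x y z : X} (hS : IsGeodesicSegment S x y)
    (hT : IsGeodesicSegment T y z) (h : dist x y + dist y z ≤ dist x z) :
    IsGeodesicSegment (S ∪ T) x z := by
  obtain ⟨a, b, γ, hab, rfl, rfl, hd, rfl⟩ := hS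
  obtain ⟨c, d, γ', hcd, hy, rfl, hd', rfl⟩ := hT
  have ha := Set.left_mem_Icc.2 hab
  have hb := Set.right_mem_Icc.2 hab
  have hc := Set.left_mem_Icc.2 hcd
  have hdm := Set.right_mem_Icc.2 hcd
  have e1 := hd a ha b hb
  have e2 := hd' c hc d hdm
  rw [abs_of_nonpos (by linarith)] at e1 e2
  rw [← hy, e2, hy, e1] at h
  set σ : ℝ → X := fun t => if t ≤ b then γ t else γ' (t - b + c) with hσ
  have hσ2 : ∀ t ∈ Set.Icc b (b + (d - c)), σ t = γ' (t - b + c) := by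
    intro t ht
    rcases eq_or_lt_of_le ht.1 with rfl | hlt
    · simp [hσ, hy]
    · simp [hσ, not_le.2 hlt]
  have key : ∀ s ∈ Set.Icc a (b + (d - c)), ∀ t ∈ Set.Icc a (b + (d - c)), s ≤ t →
      dist (σ s) (σ t) = |s - t| := by
    intro s hs t ht hst
    by_cases h1 : t ≤ b
    · have h2 : s ≤ b := hst.trans h1
      simpa [hσ, h1, h2] using hd s ⟨hs.1, h2⟩ t ⟨ht.1, h1⟩
    · push Not at h1
      have ht' : t - b + c ∈ Set.Icc c d := ⟨by linarith, by linarith [ht.2]⟩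
      by_cases h2 : s ≤ b
      · have hs' : s ∈ Set.Icc a b := ⟨hs.1, h2⟩
        have e3 := hd s hs' b hb
        have e4 := hd' c hc _ ht'
        have e5 := hd a ha s hs'
        have e6 := hd' _ ht' d hdm
        rw [abs_of_nonpos (by linarith [hs.1, ht.1, ht.2])] at e3 e4 e5 e6
        have t1 := dist_triangle (γ s) (γ b) (γ' (t - b + c))
        have t2 := dist_triangle4 (γ a) (γ s) (γ' (t - b + c)) (γ' d)
        rw [hy] at e4
        rw [abs_of_nonpos (by linarith)]
        simp only [hσ, h2, not_le.2 h1, if_true, if_false]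
        linarith
      · push Not at h2
        have hs' : s - b + c ∈ Set.Icc c d := ⟨by linarith, by linarith [hs.2]⟩
        have := hd' _ hs' _ ht'
        simp only [hσ, not_le.2 h1, not_le.2 h2, if_false, this]
        congr 1
        ring
  refine ⟨a, b + (d - c), σ, by linarith, ?_, ?_, ?_, ?_⟩
  · simp [hσ, hab]
  · rw [hσ2 _ ⟨by linarith, le_rfl⟩]
    congr 1
    ring
  · intro s hs t ht
    rcases le_total s t with hst | hst
    · exact key s hs t ht hst
    · rw [dist_comm, abs_sub_comm]
      exact key t ht s hs hst
  · ext q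
    constructor
    · rintro (⟨t, ht, rfl⟩ | ⟨t, ht, rfl⟩)
      · exact ⟨t, ⟨ht.1, by linarith [ht.2]⟩, by simp [hσ, ht.2]⟩
      · refine ⟨t - c + b, ⟨by linarith [ht.1], by linarith [ht.2]⟩, ?_⟩
        rw [hσ2 _ ⟨by linarith [ht.1], by linarith [ht.2]⟩]
        congr 1
        ring
    · rintro ⟨t, ht, rfl⟩
      by_cases h1 : t ≤ b
      · exact Or.inl ⟨t, ⟨ht.1, h1⟩, by simp [hσ, h1]⟩
      · push Not at h1
        exact Or.inr ⟨t - b + c, ⟨by linarith, by linarith [ht.2]⟩,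
          (hσ2 t ⟨h1.le, ht.2⟩).symm⟩

/-- `p` cuts `S` off: every path between `S` and its complement has to visit `p`, which is
expressed through the distances. -/
def CutsOff (p : X) (S : Set X) : Prop :=
  ∀ x ∈ S, ∀ y ∉ S, dist x y = dist x p + dist p y

/-- A geodesic between the two sides of a cut point visits the cut point. -/
theorem CutsOff.mem {p x y : X} {S A : Set X} (hp : CutsOff p S) (hx : x ∈ S) (hy : y ∉ S)
    (hA : IsGeodesicSegment A x y) : p ∈ A := by
  have hxy := hp x hx y hy
  obtain ⟨a, b, γ, hab, rfl, rfl, hd, rfl⟩ := hA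
  have ha := Set.left_mem_Icc.2 hab
  have hb := Set.right_mem_Icc.2 hab
  have e1 := hd a ha b hb
  rw [abs_of_nonpos (by linarith)] at e1
  have n1 := dist_nonneg (x := γ a) (y := p)
  have n2 := dist_nonneg (x := p) (y := γ b)
  have ht : a + dist (γ a) p ∈ Set.Icc a b := ⟨by linarith, by linarith⟩
  refine ⟨a + dist (γ a) p, ht, ?_⟩
  have e2 := hd a ha _ ht
  have e3 := hd _ ht b hb
  rw [abs_of_nonpos (by linarith)] at e2 e3
  have n3 := dist_nonneg (x := γ (a + dist (γ a) p)) (y := p)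
  by_cases hS : γ (a + dist (γ a) p) ∈ S
  · have := hp _ hS _ hy
    exact dist_le_zero.1 (by linarith)
  · have := hp _ hx _ hS
    rw [dist_comm p] at this
    exact dist_le_zero.1 (by linarith)

theorem CutsOff.mem_union {p x y z : X} {S A B : Set X} (hp : CutsOff p S) (hx : x ∈ S)
    (hy : y ∉ S) (hA : IsGeodesicSegment A y z) (hB : IsGeodesicSegment B z x) : p ∈ A ∪ B := by
  by_cases hz : z ∈ S
  · exact Or.inl (hp.mem hz hy hA.symm)
  · exact Or.inr (hp.mem hx hz hB.symm)

/-- An upper bound for the hyperbolicity constant only has to be checked on one side of each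
triangle. -/
theorem hyperbolicityConst_le {r : ℝ}
    (h : ∀ (x y z p : X) (A B C : Set X), IsGeodesicSegment A x y → IsGeodesicSegment B y z →
      IsGeodesicSegment C z x → p ∈ A → ∃ q ∈ B ∪ C, dist p q ≤ r) :
    hyperbolicityConst X ≤ ENNReal.ofReal r := by
  refine sSup_le ?_
  rintro _ ⟨x, y, z, A, B, C, hA, hB, hC, rfl⟩
  have key : ∀ (x y z : X) (A B C : Set X), IsGeodesicSegment A x y → IsGeodesicSegment B y z →
      IsGeodesicSegment C z x → ∀ p ∈ A, Metric.infEDist p (B ∪ C) ≤ ENNReal.ofReal r := by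
    intro x y z A B C hA hB hC p hp
    obtain ⟨q, hq, hpq⟩ := h x y z p A B C hA hB hC hp
    refine (Metric.infEDist_le_edist_of_mem hq).trans ?_
    rw [edist_dist]
    exact ENNReal.ofReal_le_ofReal hpq
  refine sInf_le ⟨key x y z A B C hA hB hC, ?_, key z x y C A B hC hA hB⟩
  rw [Set.union_comm]
  exact key y z x B C A hB hC hA

/-- Lower bound from a geodesic bigon, seen as a triangle with two equal vertices. -/
theorem le_hyperbolicityConst {r : ℝ} {x y p : X} {A B : Set X} (hA : IsGeodesicSegment A x y)
    (hB : IsGeodesicSegment B x y) (hp : p ∈ A) (h : ∀ q ∈ B, r ≤ dist p q) :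
    ENNReal.ofReal r ≤ hyperbolicityConst X := by
  refine le_trans ?_ (le_sSup ⟨x, y, y, A, {y}, B, hA, IsGeodesicSegment.refl y, hB.symm, rfl⟩)
  refine le_sInf fun δ hδ => ?_
  refine le_trans ?_ (hδ.1 p hp)
  rw [Metric.le_infEDist]
  intro q hq
  rw [edist_dist]
  refine ENNReal.ofReal_le_ofReal (h q ?_)
  rcases hq with hq | hq
  · rw [Set.mem_singleton_iff.1 hq]
    exact hB.right_mem
  · exact hq

/-- If a point `c` cuts the space into pieces whose diameters, together with `c`, are at most
`D`, then the space is `D / 2`-hyperbolic: on a geodesic inside one piece every point is within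
`D / 2` of an endpoint, and a geodesic between two pieces passes through `c`, as does then
another side of the triangle. -/
theorem hyperbolicityConst_le_of_cutsOff {D : ℝ} (hD : 0 ≤ D) (c : X)
    (h : ∀ p ≠ c, ∃ S, p ∈ S ∧ c ∉ S ∧ CutsOff c S ∧ (∀ x ∈ S, ∀ y ∈ S, dist x y ≤ D) ∧
      ∀ x ∈ S, dist x c ≤ D) :
    hyperbolicityConst X ≤ ENNReal.ofReal (D / 2) := by
  refine hyperbolicityConst_le fun x y z p A B C hA hB hC hp => ?_
  have hxyp := hA.dist_add_dist hp
  have hxC := hC.right_mem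
  have hyB := hB.left_mem
  -- A point of a geodesic of length at most `D` is close to one of its endpoints.
  have near : ∀ u ∈ B ∪ C, ∀ v ∈ B ∪ C, dist u p + dist p v ≤ D →
      ∃ q ∈ B ∪ C, dist p q ≤ D / 2 := by
    intro u hu v hv huv
    by_cases h1 : dist p v ≤ D / 2
    · exact ⟨v, hv, h1⟩
    · exact ⟨u, hu, by rw [dist_comm]; linarith⟩
  by_cases hpc : p = c
  · subst hpc
    by_cases hxp : x = p
    · exact ⟨x, Or.inr hxC, by rw [hxp, dist_self]; linarith⟩
    obtain ⟨S, hxS, -, hcut, hdiam, -⟩ := h x hxp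
    by_cases hyS : y ∈ S
    · exact near x (Or.inr hxC) y (Or.inl hyB) (by linarith [hdiam x hxS y hyS])
    · exact ⟨p, hcut.mem_union hxS hyS hB hC, by rw [dist_self]; linarith⟩
  obtain ⟨S, hpS, hcS, hcut, hdiam, hdc⟩ := h p hpc
  by_cases hxS : x ∈ S <;> by_cases hyS : y ∈ S
  · exact near x (Or.inr hxC) y (Or.inl hyB) (by linarith [hdiam x hxS y hyS])
  · refine near x (Or.inr hxC) c (hcut.mem_union hxS hyS hB hC) ?_
    have e1 := hcut x hxS y hyS
    have e2 := hcut p hpS y hyS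
    linarith [hdc x hxS]
  · have hm := hcut.mem_union hyS hxS hC.symm hB.symm
    rw [Set.union_comm] at hm
    refine near c hm y (Or.inl hyB) ?_
    have e1 := hcut y hyS x hxS
    have e2 := hcut p hpS x hxS
    have := hdc y hyS
    rw [dist_comm y x] at e1
    rw [dist_comm p x] at e2
    rw [dist_comm y c] at e1 this
    rw [dist_comm p c] at e2
    linarith
  · exfalso
    have e1 := hcut p hpS x hxS
    have e2 := hcut p hpS y hyS
    have e3 := dist_triangle x c y
    rw [dist_comm p x, dist_comm c x] at e1
    have := dist_pos.2 hpc
    linarith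

/-- If every point cuts the space into pieces none of which contains the endpoints of a geodesic
through that point, then every triangle is a tripod. -/
theorem hyperbolicityConst_eq_zero_of_cutsOff
    (h : ∀ p x : X, x ≠ p → ∃ S, x ∈ S ∧ CutsOff p S ∧
      ∀ y ∈ S, dist x y < dist x p + dist p y) :
    hyperbolicityConst X = 0 := by
  refine le_antisymm ?_ zero_le
  rw [← ENNReal.ofReal_zero]
  refine hyperbolicityConst_le fun x y z p A B C hA hB hC hp => ?_
  by_cases hxp : x = p
  · exact ⟨x, Or.inr hC.right_mem, by rw [hxp, dist_self]⟩
  obtain ⟨S, hxS, hcut, hlt⟩ := h p x hxp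
  have hyS : y ∉ S := fun hyS => (hlt y hyS).ne (hA.dist_add_dist hp).symm
  exact ⟨p, hcut.mem_union hxS hyS hB hC, by rw [dist_self]⟩

end Metric

/-! ### Distances and geodesics in metric graphs -/

namespace MetricGraph

variable {V : Type*} [Fintype V] {G : SimpleGraph V} {hG : G.Connected}

/-- `x` lies on the closed segment with endpoints `u` and `v`; this is meant for `u`, `v`
adjacent or equal. -/
def IsOn (x : MetricGraph G hG) (u v : V) : Prop :=
  ∀ w, x.coord w ≠ 0 → w = u ∨ w = v

theorem IsOn.symm {x : MetricGraph G hG} {u v : V} (h : x.IsOn u v) : x.IsOn v u :=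
  fun w hw => (h w hw).symm

theorem IsOn.coord_eq_zero {x : MetricGraph G hG} {u v w : V} (h : x.IsOn u v) (hu : w ≠ u)
    (hv : w ≠ v) : x.coord w = 0 := by
  by_contra h0
  exact (h w h0).elim hu hv

open Classical in
/-- A vertex, as a point of the metric graph. -/
noncomputable def vtx (hG : G.Connected) (u : V) : MetricGraph G hG where
  coord := Pi.single u 1
  nonneg w := by
    by_cases h : w = u
    · subst h; simp
    · simp [h]
  sum_eq_one := by simp
  supp := ⟨u, u, Or.inl rfl, fun w hw => by
    by_contra h
    push Not at h
    exact hw (by simp [h.1])⟩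

@[simp] theorem vtx_self (u : V) : (vtx hG u).coord u = 1 := by simp [vtx]

theorem vtx_of_ne {u w : V} (h : w ≠ u) : (vtx hG u).coord w = 0 := by simp [vtx, h]

theorem eq_of_vtx_ne_zero {u w : V} (h : (vtx hG u).coord w ≠ 0) : w = u := by
  by_contra h0
  exact h (vtx_of_ne h0)

theorem vtx_isOn_left (u v : V) : (vtx hG u).IsOn u v := fun _ hw => Or.inl (eq_of_vtx_ne_zero hw)

theorem vtx_isOn_right (u v : V) : (vtx hG v).IsOn u v := (vtx_isOn_left v u).symm

theorem eq_vtx {x : MetricGraph G hG} {u : V} (h : ∀ w, x.coord w ≠ 0 → w = u) :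
    x = vtx hG u := by
  refine MetricGraph.ext (funext fun w => ?_)
  by_cases hw : w = u
  · rw [hw, x.eq_one h, vtx_self]
  · rw [vtx_of_ne hw]
    by_contra h0
    exact hw (h w h0)

open Classical in
/-- The point at distance `t` from `u` on the edge `[u, v]`. -/
noncomputable def edgePt (hG : G.Connected) {u v : V} (h : G.Adj u v) (t : Set.Icc (0 : ℝ) 1) :
    MetricGraph G hG where
  coord := Pi.single u (1 - t.1) + Pi.single v t.1
  nonneg w := by
    have h1 := t.2.1
    have h2 := t.2.2
    simp only [Pi.add_apply, Pi.single_apply]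
    split_ifs <;> linarith
  sum_eq_one := by simp [Finset.sum_add_distrib]
  supp := ⟨u, v, Or.inr h, fun w hw => by
    by_contra h
    push Not at h
    exact hw (by simp [h.1, h.2])⟩

theorem edgePt_left {u v : V} (h : G.Adj u v) (t : Set.Icc (0 : ℝ) 1) :
    (edgePt hG h t).coord u = 1 - t.1 := by simp [edgePt, h.ne]

theorem edgePt_right {u v : V} (h : G.Adj u v) (t : Set.Icc (0 : ℝ) 1) :
    (edgePt hG h t).coord v = t.1 := by simp [edgePt, h.ne']

theorem edgePt_isOn {u v : V} (h : G.Adj u v) (t : Set.Icc (0 : ℝ) 1) :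
    (edgePt hG h t).IsOn u v := by
  intro w hw
  by_contra h
  push Not at h
  exact hw (by simp [edgePt, h.1, h.2])

theorem dist_eq_pathDist (x y : MetricGraph G hG) : dist x y = pathDist x y := rfl

theorem abs_coord_sub_le (x y : MetricGraph G hG) (w : V) :
    |x.coord w - y.coord w| ≤ dist x y :=
  (dist_le_pi_dist x.coord y.coord w).trans (coord_dist_le_pathDist x y)

/-- On an edge the distance is that of the unit interval. -/
theorem IsOn.dist_eq {x y : MetricGraph G hG} {u v : V} (h : G.Adj u v) (hx : x.IsOn u v)
    (hy : y.IsOn u v) : dist x y = |x.coord u - y.coord u| := by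
  refine le_antisymm ?_ (abs_coord_sub_le x y u)
  rw [dist_eq_pathDist, pathDist_same ⟨u, v, Or.inr h, hx, hy⟩,
    dist_pi_le_iff (abs_nonneg _)]
  intro w
  rw [Real.dist_eq]
  by_cases hu : w = u
  · rw [hu]
  by_cases hv : w = v
  · have h1 := x.add_eq_one h.ne hx
    have h2 := y.add_eq_one h.ne hy
    rw [hv, show x.coord v - y.coord v = -(x.coord u - y.coord u) by linarith, abs_neg]
  · rw [hx.coord_eq_zero hu hv, hy.coord_eq_zero hu hv]
    simp

theorem IsOn.ext {x y : MetricGraph G hG} {u v : V} (h : G.Adj u v) (hx : x.IsOn u v)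
    (hy : y.IsOn u v) (hxy : x.coord u = y.coord u) : x = y := by
  refine dist_le_zero.1 ?_
  rw [hx.dist_eq h hy, hxy, sub_self, abs_zero]

theorem IsOn.dist_vtx {x : MetricGraph G hG} {u v : V} (h : G.Adj u v) (hx : x.IsOn u v) :
    dist x (vtx hG u) = 1 - x.coord u := by
  rw [hx.dist_eq h (vtx_isOn_left u v), vtx_self, abs_sub_comm, abs_of_nonneg]
  linarith [x.coord_le_one u]

theorem dist_vtx_vtx (u v : V) : dist (vtx hG u) (vtx hG v) = G.dist u v := by
  have h0 := pathDist_le (vtx hG u) (vtx hG v) (u := u) (v := v) (by simp) (by simp)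
  simp only [vtx_self, sub_self, zero_add, add_zero] at h0
  refine le_antisymm h0 ?_
  rw [dist_eq_pathDist]
  by_cases hs : SameEdge (vtx hG u) (vtx hG v)
  · by_cases huv : u = v
    · subst huv
      simp [← dist_eq_pathDist]
    · have hadj : G.Adj u v := by
        obtain ⟨a, b, hab, h1, h2⟩ := hs
        have e1 := h1 u (by simp)
        have e2 := h2 v (by simp)
        rcases hab with rfl | hab
        · grind
        · rcases e1 with rfl | rfl <;> rcases e2 with rfl | rfl <;>
            first | exact absurd rfl huv | exact hab | exact hab.symm
      rw [SimpleGraph.dist_eq_one_iff_adj.2 hadj]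
      have := abs_coord_sub_le (vtx hG u) (vtx hG v) u
      rw [vtx_self, vtx_of_ne huv] at this
      rw [← dist_eq_pathDist]
      simpa using this
  · obtain ⟨a, b, ha, hb, e⟩ := pathDist_exists hs
    rw [eq_of_vtx_ne_zero ha, eq_of_vtx_ne_zero hb] at e
    simp [e]

/-- A shortest path from a vertex to a point `x` enters the edge of `x` through an endpoint. -/
theorem exists_dist_vtx_eq (r : V) (x : MetricGraph G hG) :
    ∃ w, x.coord w ≠ 0 ∧ dist (vtx hG r) x = G.dist r w + (1 - x.coord w) := by
  by_cases hs : SameEdge (vtx hG r) x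
  · obtain ⟨a, b, hab, h1, h2⟩ := hs
    by_cases hr : x.coord r = 0
    · obtain ⟨w, hw⟩ := x.exists_ne
      have hx : x = vtx hG w := by
        refine eq_vtx fun w' hw' => ?_
        have := h1 r (by simp)
        have := h2 w hw
        have := h2 w' hw'
        grind
      exact ⟨w, hw, by rw [hx, dist_vtx_vtx, vtx_self]; simp⟩
    · refine ⟨r, hr, ?_⟩
      rcases hab with rfl | hab
      · have hra : r = a := (h1 r (by simp)).elim id id
        have hx : x = vtx hG r := eq_vtx fun w hw => hra ▸ (h2 w hw).elim id id
        rw [hx]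
        simp
      · rw [dist_comm]
        rcases h1 r (by simp) with rfl | rfl
        · simpa using IsOn.dist_vtx hab h2
        · simpa using IsOn.dist_vtx hab.symm (IsOn.symm h2)
  · obtain ⟨a, b, ha, hb, e⟩ := pathDist_exists hs
    rw [eq_of_vtx_ne_zero ha] at e
    exact ⟨b, hb, by rw [dist_eq_pathDist, e]; simp⟩

theorem dist_le_of_isOn {x y : MetricGraph G hG} {a b d e : V} (hab : G.Adj a b)
    (hde : G.Adj d e) (hx : x.IsOn a b) (hy : y.IsOn d e) :
    dist x y ≤ (1 - x.coord a) + G.dist a d + (1 - y.coord d) := by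
  have h := dist_triangle4 x (vtx hG a) (vtx hG d) y
  rwa [dist_vtx_vtx, hx.dist_vtx hab, dist_comm (vtx hG d) y, hy.dist_vtx hde] at h

/-- Two points which are not on a common edge are far from each other as soon as all the paths
through the endpoints of their edges are long. -/
theorem le_dist_of_not_sameEdge {x y : MetricGraph G hG} {r : ℝ} (hs : ¬ SameEdge x y)
    (h : ∀ u v, x.coord u ≠ 0 → y.coord v ≠ 0 →
      r ≤ (1 - x.coord u) + G.dist u v + (1 - y.coord v)) : r ≤ dist x y := by
  obtain ⟨u, v, hu, hv, e⟩ := pathDist_exists hs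
  rw [dist_eq_pathDist, e]
  exact h u v hu hv

/-- The part of the edge `[u, v]` between `x` and `y`, where `x` is the point nearer to `u`. -/
def edgeSeg (u v : V) (x y : MetricGraph G hG) : Set (MetricGraph G hG) :=
  {q | q.IsOn u v ∧ q.coord u ∈ Set.Icc (y.coord u) (x.coord u)}

theorem isGeodesicSegment_edgeSeg {u v : V} (h : G.Adj u v) {x y : MetricGraph G hG}
    (hx : x.IsOn u v) (hy : y.IsOn u v) (hxy : y.coord u ≤ x.coord u) :
    IsGeodesicSegment (edgeSeg u v x y) x y := by
  have hl : ∀ t ∈ Set.Icc (1 - x.coord u) (1 - y.coord u),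
      (edgePt hG h (Set.projIcc 0 1 zero_le_one t)).coord u = 1 - t := by
    intro t ht
    rw [edgePt_left, Set.projIcc_of_mem zero_le_one
      ⟨by linarith [ht.1, x.coord_le_one u], by linarith [ht.2, y.nonneg u]⟩]
  refine ⟨1 - x.coord u, 1 - y.coord u,
    fun t => edgePt hG h (Set.projIcc 0 1 zero_le_one t), by linarith, ?_, ?_, ?_, ?_⟩
  · refine (edgePt_isOn h _).ext h hx ?_
    rw [hl _ ⟨le_rfl, by linarith⟩, sub_sub_cancel]
  · refine (edgePt_isOn h _).ext h hy ?_
    rw [hl _ ⟨by linarith, le_rfl⟩, sub_sub_cancel]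
  · intro s hs t ht
    rw [(edgePt_isOn h _).dist_eq h (edgePt_isOn h _), hl s hs, hl t ht, abs_sub_comm]
    congr 1
    ring
  · ext q
    constructor
    · rintro ⟨hq, hq1, hq2⟩
      have hm : 1 - q.coord u ∈ Set.Icc (1 - x.coord u) (1 - y.coord u) :=
        ⟨by linarith, by linarith⟩
      refine ⟨1 - q.coord u, hm, (edgePt_isOn h _).ext h hq ?_⟩
      rw [hl _ hm, sub_sub_cancel]
    · rintro ⟨t, ht, rfl⟩
      refine ⟨edgePt_isOn h _, ?_⟩
      rw [hl t ht]
      exact ⟨by linarith [ht.2], by linarith [ht.1]⟩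

theorem isGeodesicSegment_edge {u v : V} (h : G.Adj u v) :
    IsGeodesicSegment (edgeSeg u v (vtx hG u) (vtx hG v)) (vtx hG u) (vtx hG v) :=
  isGeodesicSegment_edgeSeg h (vtx_isOn_left u v) (vtx_isOn_right u v)
    (by rw [vtx_self, vtx_of_ne h.ne]; exact zero_le_one)

end MetricGraph

/-! ### Lower bounds from geodesic bigons -/

namespace MetricGraph

/-- A vertex other than the root has a parent in the tree of distances to the root. -/
theorem exists_parent {V : Type*} {G : SimpleGraph V} (hG : G.Connected) {r v : V}
    (h : r ≠ v) :
    ∃ a, G.Adj a v ∧ G.dist r v = G.dist r a + 1 := by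
  obtain ⟨p, hp⟩ := hG.exists_walk_length_eq_dist v r
  cases p with
  | nil => exact absurd rfl h
  | @cons _ a _ hadj p =>
    refine ⟨a, hadj.symm, le_antisymm ?_ ?_⟩
    · have := hG.dist_triangle (u := r) (v := a) (w := v)
      rwa [SimpleGraph.dist_eq_one_iff_adj.2 hadj.symm] at this
    · rw [SimpleGraph.Walk.length_cons] at hp
      have := SimpleGraph.dist_le p
      rw [SimpleGraph.dist_comm (u := r) (v := v), SimpleGraph.dist_comm (u := r) (v := a)]
      omega

variable {V : Type*} [Fintype V] {G : SimpleGraph V} {hG : G.Connected}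

theorem one_le_dist_vtx {q : MetricGraph G hG} {a : V} (h : q.coord a = 0) :
    1 ≤ dist (vtx hG a) q := by
  have := abs_coord_sub_le (vtx hG a) q a
  rwa [vtx_self, h, sub_zero, abs_one] at this

/-- A geodesic from `r` to `v` may be prolonged along an edge that increases the distance
to `r`. -/
theorem isGeodesicSegment_cons {r a v : V} (hav : G.Adj a v)
    (hd : G.dist r v = G.dist r a + 1) {S : Set (MetricGraph G hG)}
    (hS : IsGeodesicSegment S (vtx hG r) (vtx hG a)) :
    IsGeodesicSegment (S ∪ edgeSeg a v (vtx hG a) (vtx hG v)) (vtx hG r) (vtx hG v) := by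
  refine hS.trans (isGeodesicSegment_edge hav) ?_
  rw [dist_vtx_vtx, dist_vtx_vtx, dist_vtx_vtx, SimpleGraph.dist_eq_one_iff_adj.2 hav, hd]
  push_cast
  exact le_rfl

/-- There is a geodesic from `r` to `v` all of whose points lie on edges with endpoints nearer
to `r` than `v`, or equal to `v`. -/
theorem exists_isGeodesicSegment (hG : G.Connected) (r v : V) :
    ∃ S, IsGeodesicSegment S (vtx hG r) (vtx hG v) ∧
      ∀ q ∈ S, ∀ w, q.coord w ≠ 0 → G.dist r w < G.dist r v ∨ w = v := by
  induction hk : G.dist r v generalizing v with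
  | zero =>
    obtain rfl := hG.dist_eq_zero_iff.1 hk
    refine ⟨_, IsGeodesicSegment.refl _, ?_⟩
    rintro q rfl w hw
    exact Or.inr (eq_of_vtx_ne_zero hw)
  | succ k ih =>
    obtain ⟨a, hav, hd⟩ := exists_parent hG (r := r) (v := v) (by
      rintro rfl
      simp at hk)
    obtain ⟨S, hS, hSw⟩ := ih a (by omega)
    refine ⟨_, isGeodesicSegment_cons hav hd hS, ?_⟩
    rintro q (hq | hq) w hw
    · rcases hSw q hq w hw with h | rfl
      · exact Or.inl (by omega)
      · exact Or.inl (by omega)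
    · rcases hq.1 w hw with rfl | rfl
      · exact Or.inl (by omega)
      · exact Or.inr rfl

/-- There is a geodesic from `r` to `v` through any given parent `a` of `v`. -/
theorem exists_isGeodesicSegment_via (hG : G.Connected) {r a v : V} (hav : G.Adj a v)
    (hd : G.dist r v = G.dist r a + 1) :
    ∃ S, IsGeodesicSegment S (vtx hG r) (vtx hG v) ∧ vtx hG a ∈ S ∧
      ∀ q ∈ S, ∀ w, q.coord w ≠ 0 → G.dist r w < G.dist r a ∨ w = a ∨ w = v := by
  obtain ⟨S, hS, hSw⟩ := exists_isGeodesicSegment hG r a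
  refine ⟨_, isGeodesicSegment_cons hav hd hS, Or.inl hS.right_mem, ?_⟩
  rintro q (hq | hq) w hw
  · exact (hSw q hq w hw).imp_right Or.inl
  · exact Or.inr (hq.1 w hw)

/-- Two geodesics with the same endpoints, one through the vertex `a` and one that avoids the open
star of `a`, form a bigon of constant at least one. -/
theorem one_le_of_bigon {x y : MetricGraph G hG} {A B : Set (MetricGraph G hG)} {a : V}
    (hA : IsGeodesicSegment A x y) (hB : IsGeodesicSegment B x y) (ha : vtx hG a ∈ A)
    (h : ∀ q ∈ B, q.coord a = 0) : 1 ≤ hyperbolicityConst (MetricGraph G hG) := by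
  rw [← ENNReal.ofReal_one]
  exact le_hyperbolicityConst hA hB ha fun q hq => one_le_dist_vtx (h q hq)

/-- The geodesics from `r` to `v` through the two parents form a bigon. -/
theorem one_le_of_two_parents (hG : G.Connected) {r a c v : V} (hac : a ≠ c) (hav : G.Adj a v)
    (hcv : G.Adj c v) (ha : G.dist r v = G.dist r a + 1) (hc : G.dist r v = G.dist r c + 1) :
    1 ≤ hyperbolicityConst (MetricGraph G hG) := by
  obtain ⟨A, hA, hmem, -⟩ := exists_isGeodesicSegment_via hG hav ha
  obtain ⟨B, hB, -, hBw⟩ := exists_isGeodesicSegment_via hG hcv hc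
  refine one_le_of_bigon hA hB hmem fun q hq => ?_
  by_contra h0
  rcases hBw q hq a h0 with h | h | h
  · omega
  · exact hac h
  · exact hav.ne h

/-- The midpoint of the edge `[u, v]`. -/
noncomputable def mid (hG : G.Connected) {u v : V} (h : G.Adj u v) : MetricGraph G hG :=
  edgePt hG h ⟨1 / 2, by norm_num, by norm_num⟩

theorem mid_isOn {u v : V} (h : G.Adj u v) : (mid hG h).IsOn u v := edgePt_isOn h _

theorem mid_left {u v : V} (h : G.Adj u v) : (mid hG h).coord u = 1 / 2 := by
  rw [mid, edgePt_left]
  norm_num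

theorem mid_right {u v : V} (h : G.Adj u v) : (mid hG h).coord v = 1 / 2 :=
  edgePt_right h _

theorem mid_symm {u v : V} (h : G.Adj u v) : mid hG h.symm = mid hG h :=
  (mid_isOn h.symm).symm.ext h (mid_isOn h) (by rw [mid_right, mid_left])

/-- A geodesic from `r` to `u` may be prolonged by half of an edge `[u, v]` between two vertices
at the same distance from `r`. -/
theorem isGeodesicSegment_mid {r u v : V} (h : G.Adj u v) (hd : G.dist r u = G.dist r v)
    {S : Set (MetricGraph G hG)} (hS : IsGeodesicSegment S (vtx hG r) (vtx hG u)) :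
    IsGeodesicSegment (S ∪ edgeSeg u v (vtx hG u) (mid hG h)) (vtx hG r) (mid hG h) := by
  refine hS.trans (isGeodesicSegment_edgeSeg h (vtx_isOn_left u v) (mid_isOn h) ?_) ?_
  · rw [vtx_self]
    exact (mid hG h).coord_le_one u
  · rw [dist_vtx_vtx, dist_comm, (mid_isOn h).dist_vtx h]
    obtain ⟨w, hw, e⟩ := exists_dist_vtx_eq r (mid hG h)
    rcases mid_isOn h w hw with rfl | rfl
    · rw [e]
    · rw [e, hd, mid_left, mid_right]

/-- The geodesics from `r` to the midpoint of `[u, v]` through the two parents form a bigon. -/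
theorem one_le_of_level_edge (hG : G.Connected) {r a c u v : V} (hac : a ≠ c) (huv : G.Adj u v)
    (hd : G.dist r u = G.dist r v) (hau : G.Adj a u) (hcv : G.Adj c v)
    (ha : G.dist r u = G.dist r a + 1) (hc : G.dist r v = G.dist r c + 1) :
    1 ≤ hyperbolicityConst (MetricGraph G hG) := by
  obtain ⟨A, hA, hmem, -⟩ := exists_isGeodesicSegment_via hG hau ha
  obtain ⟨B, hB, -, hBw⟩ := exists_isGeodesicSegment_via hG hcv hc
  have hav : a ≠ v := by rintro rfl; omega
  have hB' := isGeodesicSegment_mid huv.symm hd.symm hB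
  rw [mid_symm huv] at hB'
  refine one_le_of_bigon (isGeodesicSegment_mid huv hd hA) hB' (Or.inl hmem) ?_
  rintro q (hq | hq)
  · by_contra h0
    rcases hBw q hq a h0 with h | h | h
    · omega
    · exact hac h
    · exact hav h
  · exact hq.1.coord_eq_zero hav hau.ne

/-- In a triangle `a`, `u`, `v` the vertex `a` and the midpoint of `[u, v]` are joined by two
geodesics of length `3 / 2`, and the midpoint of one is at distance `3 / 4` from the other. -/
theorem three_quarters_le_of_triangle (hG : G.Connected) {a u v : V} (hau : G.Adj a u)
    (hav : G.Adj a v) (huv : G.Adj u v) :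
    3 / 4 ≤ hyperbolicityConst (MetricGraph G hG) := by
  have hd : G.dist a u = G.dist a v := by
    rw [SimpleGraph.dist_eq_one_iff_adj.2 hau, SimpleGraph.dist_eq_one_iff_adj.2 hav]
  have hA := isGeodesicSegment_mid huv hd (isGeodesicSegment_edge (hG := hG) hau)
  have hB := isGeodesicSegment_mid huv.symm hd.symm (isGeodesicSegment_edge (hG := hG) hav)
  rw [mid_symm huv] at hB
  set p : MetricGraph G hG := edgePt hG hau ⟨3 / 4, by norm_num, by norm_num⟩ with hp
  have hpa : p.coord a = 1 / 4 := by
    rw [hp, edgePt_left]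
    norm_num
  have hpu : p.coord u = 3 / 4 := edgePt_right hau _
  have hpo : p.IsOn a u := edgePt_isOn hau _
  have hr : (3 / 4 : ℝ≥0∞) = ENNReal.ofReal (3 / 4) := by
    rw [ENNReal.ofReal_div_of_pos (by norm_num)]
    norm_num
  rw [hr]
  refine le_hyperbolicityConst hA hB (p := p) ?_ ?_
  · refine Or.inl ⟨hpo, ?_, ?_⟩
    · rw [vtx_of_ne hau.ne]
      exact p.nonneg a
    · rw [vtx_self]
      exact p.coord_le_one a
  · intro q hq
    by_cases hqv : q.coord v = 0
    · -- Then `q` is the vertex `a`, as the rest of the other side lies near `v`.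
      have hqu : q.coord u = 0 := by
        rcases hq with hq | hq
        · exact hq.1.coord_eq_zero hau.ne' huv.ne
        · have := hq.2.1
          rw [mid_right, hqv] at this
          norm_num at this
      have := abs_coord_sub_le p q u
      rwa [hpu, hqu, sub_zero, abs_of_pos (by norm_num)] at this
    · refine le_dist_of_not_sameEdge ?_ ?_
      · rintro ⟨b, d, -, h1, h2⟩
        have e1 := h1 a (by rw [hpa]; norm_num)
        have e2 := h1 u (by rw [hpu]; norm_num)
        have e3 := h2 v hqv
        have := hau.ne
        have := hav.ne
        have := huv.ne
        grind
      · intro w w' hw hw'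
        have h1 := q.coord_le_one w'
        rcases eq_or_ne w w' with rfl | hne
        · rw [SimpleGraph.dist_self]
          rcases hpo w hw with rfl | rfl
          · rw [hpa]
            norm_num
            linarith
          · have hqw : q.coord w ≤ 1 / 2 := by
              rcases hq with hq | hq
              · exact absurd (hq.1.coord_eq_zero hau.ne' huv.ne) hw'
              · have h3 := hq.2.1
                have h4 := q.add_le_one huv.ne
                rw [mid_right] at h3
                linarith
            rw [hpu]
            norm_num
            linarith
        · have h2 : (1 : ℝ) ≤ G.dist w w' := by
            exact_mod_cast hG.pos_dist_of_ne hne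
          have h3 := p.coord_le_one w
          linarith

/-- In a complete graph on `a`, `b`, `c`, `d` the midpoints of `[a, b]` and `[c, d]` are at
distance two; the midpoint of `[a, c]` lies on a geodesic between them and is at distance one from
the geodesic through `b` and `d`. -/
theorem one_le_of_complete_four (hG : G.Connected) {a b c d : V} (hab : G.Adj a b)
    (hac : G.Adj a c) (had : G.Adj a d) (hbc : G.Adj b c) (hbd : G.Adj b d) (hcd : G.Adj c d) :
    1 ≤ hyperbolicityConst (MetricGraph G hG) := by
  have dist_one : ∀ {u v : V}, G.Adj u v → dist (vtx hG u) (vtx hG v) = 1 := fun h => by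
    rw [dist_vtx_vtx, SimpleGraph.dist_eq_one_iff_adj.2 h, Nat.cast_one]
  have half : ∀ {u v : V} (h : G.Adj u v), IsGeodesicSegment (edgeSeg u v (vtx hG u) (mid hG h))
      (vtx hG u) (mid hG h) := fun {u v} h =>
    isGeodesicSegment_edgeSeg h (vtx_isOn_left u v) (mid_isOn h)
      (by rw [vtx_self]; exact (mid hG h).coord_le_one u)
  have half_dist : ∀ {u v : V} (h : G.Adj u v), dist (vtx hG u) (mid hG h) = 1 / 2 :=
    fun h => by
      rw [dist_comm, (mid_isOn h).dist_vtx h, mid_left]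
      norm_num
  have hxy : 2 ≤ dist (mid hG hab) (mid hG hcd) := by
    refine le_dist_of_not_sameEdge ?_ ?_
    · rintro ⟨u, v, -, h1, h2⟩
      have e1 := h1 a (by rw [mid_left]; norm_num)
      have e2 := h1 b (by rw [mid_right]; norm_num)
      have e3 := h2 c (by rw [mid_left]; norm_num)
      have := hab.ne
      have := hac.ne
      have := hbc.ne
      grind
    · intro u v hu hv
      have h1 : (1 : ℝ) ≤ G.dist u v := by
        have : u ≠ v := by
          have := mid_isOn hab u hu
          have := mid_isOn hcd v hv
          have := hac.ne
          have := had.ne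
          have := hbc.ne
          have := hbd.ne
          grind
        exact_mod_cast hG.pos_dist_of_ne this
      have h2 : (mid hG hab).coord u = 1 / 2 := by
        rcases mid_isOn hab u hu with rfl | rfl
        · exact mid_left hab
        · exact mid_right hab
      have h3 : (mid hG hcd).coord v = 1 / 2 := by
        rcases mid_isOn hcd v hv with rfl | rfl
        · exact mid_left hcd
        · exact mid_right hcd
      linarith
  -- The geodesic between the two midpoints along the edge `[u, w]`.
  have side : ∀ {u v w z : V} (huv : G.Adj u v) (huw : G.Adj u w) (hwz : G.Adj w z),
      mid hG huv = mid hG hab → mid hG hwz = mid hG hcd →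
      IsGeodesicSegment (edgeSeg u v (vtx hG u) (mid hG huv) ∪
        (edgeSeg u w (vtx hG u) (vtx hG w) ∪ edgeSeg w z (vtx hG w) (mid hG hwz)))
        (mid hG hab) (mid hG hcd) := by
    intro u v w z huv huw hwz e1 e2
    have t1 := dist_triangle (mid hG huv) (vtx hG u) (mid hG hwz)
    have t2 := dist_triangle (vtx hG u) (vtx hG w) (mid hG hwz)
    have d1 := half_dist huv
    have d2 := half_dist hwz
    have d3 := dist_one huw
    rw [dist_comm] at d1
    have hxy' := hxy
    rw [← e1, ← e2] at hxy' ⊢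
    refine (half huv).symm.trans ((isGeodesicSegment_edge huw).trans (half hwz) ?_) ?_
    · linarith
    · linarith
  have hA := side hab hac hcd rfl rfl
  have hB := side hab.symm hbd hcd.symm (mid_symm hab) (mid_symm hcd)
  rw [← ENNReal.ofReal_one]
  refine le_hyperbolicityConst hA hB (p := mid hG hac) ?_ ?_
  · refine Or.inr (Or.inl ⟨mid_isOn hac, ?_, ?_⟩)
    · rw [vtx_of_ne hac.ne]
      exact (mid hG hac).nonneg a
    · rw [vtx_self]
      exact (mid hG hac).coord_le_one a
  · intro q hq
    have hne1 := hab.ne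
    have hne2 := hac.ne
    have hne3 := had.ne
    have hne4 := hbc.ne
    have hne5 := hbd.ne
    have hne6 := hcd.ne
    -- No point of the side through `b` and `d` is near `a` or `c`.
    have hq' : q.coord a ≤ 1 / 2 ∧ q.coord c ≤ 1 / 2 ∧ (q.coord b ≠ 0 ∨ q.coord d ≠ 0) := by
      rcases hq with ⟨ho, hq, -⟩ | ⟨ho, hq, -⟩ | ⟨ho, hq, -⟩
      · rw [mid_left] at hq
        have h1 := q.add_le_one hne1
        rw [ho.coord_eq_zero hne4.symm hne2.symm]
        exact ⟨by linarith, by norm_num, Or.inl (by intro h; linarith)⟩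
      · rw [ho.coord_eq_zero hne4.symm hne6, ho.coord_eq_zero hne1 hne3]
        refine ⟨by norm_num, by norm_num, ?_⟩
        by_contra! h
        have := q.add_eq_one hne5 ho
        linarith [h.1, h.2]
      · rw [mid_left] at hq
        have h1 := q.add_le_one hne6
        rw [ho.coord_eq_zero hne3 hne2]
        exact ⟨by norm_num, by linarith, Or.inr (by intro h; linarith)⟩
    refine le_dist_of_not_sameEdge ?_ ?_
    · rintro ⟨u, v, -, h1, h2⟩
      have e1 := h1 a (by rw [mid_left]; norm_num)
      have e2 := h1 c (by rw [mid_right]; norm_num)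
      rcases hq'.2.2 with h | h
      · have e3 := h2 b h
        grind
      · have e3 := h2 d h
        grind
    · intro w w' hw hw'
      have h1 := q.coord_le_one w'
      have h2 : (mid hG hac).coord w = 1 / 2 := by
        rcases mid_isOn hac w hw with rfl | rfl
        · exact mid_left hac
        · exact mid_right hac
      rw [h2]
      rcases eq_or_ne w w' with rfl | hne
      · rw [SimpleGraph.dist_self]
        have : q.coord w ≤ 1 / 2 := by
          rcases mid_isOn hac w hw with rfl | rfl
          · exact hq'.1
          · exact hq'.2.1
        norm_num
        linarith
      · have h3 : (1 : ℝ) ≤ G.dist w w' := by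
          exact_mod_cast hG.pos_dist_of_ne hne
        linarith

end MetricGraph

/-! ### Counting edges along the levels of distance to a root -/

namespace MetricGraph

variable {V : Type*} [Fintype V] {G : SimpleGraph V}

/-- In a graph of constant less than one, adjacent vertices at the same distance from `r` have
the same parent. -/
theorem exists_common_parent (hG : G.Connected)
    (h1 : hyperbolicityConst (MetricGraph G hG) < 1) {r u v : V} (huv : G.Adj u v)
    (hd : G.dist r u = G.dist r v) :
    ∃ a, G.Adj a u ∧ G.Adj a v ∧ G.dist r u = G.dist r a + 1 := by
  have hru : r ≠ u := by
    rintro rfl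
    rw [SimpleGraph.dist_self, SimpleGraph.dist_eq_one_iff_adj.2 huv] at hd
    exact absurd hd (by norm_num)
  have hrv : r ≠ v := by
    rintro rfl
    rw [SimpleGraph.dist_self, SimpleGraph.dist_eq_one_iff_adj.2 huv.symm] at hd
    exact absurd hd (by norm_num)
  obtain ⟨a, hau, ha⟩ := exists_parent hG hru
  obtain ⟨c, hcv, hc⟩ := exists_parent hG hrv
  by_cases hac : a = c
  · subst hac
    exact ⟨a, hau, hcv, ha⟩
  · exact absurd h1 (not_lt.2 (one_le_of_level_edge hG hac huv hd hau hcv ha hc))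

/-- In a graph of constant less than one, each vertex has at most one neighbour at the same
distance from `r`. -/
theorem level_neighbor_unique (hG : G.Connected)
    (h1 : hyperbolicityConst (MetricGraph G hG) < 1) {r u v w : V} (huv : G.Adj u v)
    (hwv : G.Adj w v) (hu : G.dist r u = G.dist r v) (hw : G.dist r w = G.dist r v) : u = w := by
  by_contra huw
  obtain ⟨a, hau, hav, ha⟩ := exists_common_parent hG h1 huv hu
  obtain ⟨c, hcw, hcv, hc⟩ := exists_common_parent hG h1 hwv hw
  have hac : a = c := by
    by_contra hac
    exact not_lt.2 (one_le_of_two_parents hG (r := r) hac hav hcv (by omega) (by omega)) h1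
  subst hac
  by_cases hadj : G.Adj u w
  · exact not_lt.2 (one_le_of_complete_four hG hau hav hcw huv hadj hwv.symm) h1
  · -- `v` and `a` are then two common neighbours of `u` and `w`.
    have hd : G.dist u w = 2 := by
      have e1 := hG.one_lt_dist_of_ne_of_not_adj huw hadj
      have e2 := hG.dist_triangle (u := u) (v := v) (w := w)
      rw [SimpleGraph.dist_eq_one_iff_adj.2 huv, SimpleGraph.dist_eq_one_iff_adj.2 hwv.symm] at e2
      omega
    refine not_lt.2 (one_le_of_two_parents hG (r := u) hav.ne hcw hwv.symm ?_ ?_) h1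
    · rw [hd, SimpleGraph.dist_eq_one_iff_adj.2 hau.symm]
    · rw [hd, SimpleGraph.dist_eq_one_iff_adj.2 huv]

open Classical in
/-- Counting adjacent pairs by their levels: each vertex other than `r` is the upper end of a
single pair of different levels. -/
theorem two_mul_card_edge_le (hG : G.Connected)
    (h1 : hyperbolicityConst (MetricGraph G hG) < 1) (r : V) :
    2 * G.edgeSet.ncard ≤ 2 * (Fintype.card V - 1) +
      ((Finset.univ : Finset (V × V)).filter
        fun e => G.Adj e.1 e.2 ∧ G.dist r e.1 = G.dist r e.2).card := by
  set Q := (Finset.univ : Finset (V × V)).filter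
    fun e => G.Adj e.1 e.2 ∧ G.dist r e.1 = G.dist r e.2 with hQ
  set P := (Finset.univ : Finset (V × V)).filter
    fun e => G.Adj e.1 e.2 ∧ G.dist r e.1 < G.dist r e.2 with hP
  have hcP : P.card ≤ Fintype.card V - 1 := by
    rw [← Finset.card_univ, ← Finset.card_erase_of_mem (Finset.mem_univ r)]
    refine Finset.card_le_card_of_injOn Prod.snd ?_ ?_
    · intro e he
      simp only [hP, Finset.coe_filter, Finset.mem_univ, true_and, Set.mem_ofPred_eq] at he
      simp only [Finset.coe_erase, Finset.coe_univ, Set.mem_sdiff, Set.mem_univ, true_and,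
        Set.mem_singleton_iff]
      intro h
      rw [h, SimpleGraph.dist_self] at he
      omega
    · rintro ⟨a, v⟩ ha ⟨c, v'⟩ hc (rfl : v = v')
      simp only [hP, Finset.coe_filter, Finset.mem_univ, true_and, Set.mem_ofPred_eq] at ha hc
      have level : ∀ {a : V}, G.Adj a v → G.dist r a < G.dist r v →
          G.dist r v = G.dist r a + 1 := by
        intro a hadj hlt
        have := hG.dist_triangle (u := r) (v := a) (w := v)
        rw [SimpleGraph.dist_eq_one_iff_adj.2 hadj] at this
        omega
      by_contra hne
      have hac : a ≠ c := fun h => hne (by rw [h])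
      exact not_lt.2 (one_le_of_two_parents hG hac ha.1 hc.1 (level ha.1 ha.2)
        (level hc.1 hc.2)) h1
  have hsub : (Finset.univ : Finset (V × V)).filter (fun e => G.Adj e.1 e.2) ⊆
      (P ∪ P.image Prod.swap) ∪ Q := by
    rintro ⟨a, b⟩ he
    simp only [Finset.mem_filter, Finset.mem_univ, true_and] at he
    simp only [hP, hQ, Finset.mem_union, Finset.mem_image, Finset.mem_filter, Finset.mem_univ,
      true_and]
    rcases lt_trichotomy (G.dist r a) (G.dist r b) with h | h | h
    · exact Or.inl (Or.inl ⟨he, h⟩)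
    · exact Or.inr ⟨he, h⟩
    · exact Or.inl (Or.inr ⟨(b, a), ⟨he.symm, h⟩, rfl⟩)
  have h2 : 2 * G.edgeSet.ncard =
      ((Finset.univ : Finset (V × V)).filter (fun e => G.Adj e.1 e.2)).card := by
    rw [Set.ncard_eq_toFinset_card', ← SimpleGraph.edgeFinset, SimpleGraph.two_mul_card_edgeFinset]
  have h3 := Finset.card_le_card hsub
  have h4 := Finset.card_union_le (P ∪ P.image Prod.swap) Q
  have h5 := Finset.card_union_le P (P.image Prod.swap)
  have h6 : (P.image Prod.swap).card ≤ P.card := Finset.card_image_le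
  omega

/-- In a graph of constant less than one the edges joining vertices of the same level form a
matching, as each vertex other than the root has at most one neighbour in its level. -/
theorem one_le_hyperbolicityConst (hG : G.Connected)
    (hm : 3 * (Fintype.card V - 1) < 2 * G.edgeSet.ncard) :
    1 ≤ hyperbolicityConst (MetricGraph G hG) := by
  classical
  by_contra! h1
  obtain ⟨r⟩ := hG.nonempty
  have h2 := two_mul_card_edge_le hG h1 r
  have hcQ : ((Finset.univ : Finset (V × V)).filter
      fun e => G.Adj e.1 e.2 ∧ G.dist r e.1 = G.dist r e.2).card ≤ Fintype.card V - 1 := by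
    rw [← Finset.card_univ, ← Finset.card_erase_of_mem (Finset.mem_univ r)]
    refine Finset.card_le_card_of_injOn Prod.snd ?_ ?_
    · intro e he
      simp only [Finset.coe_filter, Finset.mem_univ, true_and, Set.mem_ofPred_eq] at he
      simp only [Finset.coe_erase, Finset.coe_univ, Set.mem_sdiff, Set.mem_univ, true_and,
        Set.mem_singleton_iff]
      intro h
      rw [h, SimpleGraph.dist_self, hG.dist_eq_zero_iff] at he
      exact he.1.ne he.2.symm
    · rintro ⟨u, v⟩ hu ⟨w, v'⟩ hw (rfl : v = v')
      simp only [Finset.coe_filter, Finset.mem_univ, true_and, Set.mem_ofPred_eq] at hu hw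
      rw [level_neighbor_unique hG h1 hu.1 hw.1 hu.2 hw.2]
  omega

/-- A graph which is not a tree has, if its constant is less than one, an edge joining two
vertices of the same level, which together with their common parent form a triangle. -/
theorem three_quarters_le_hyperbolicityConst (hG : G.Connected)
    (hm : Fintype.card V ≤ G.edgeSet.ncard) :
    3 / 4 ≤ hyperbolicityConst (MetricGraph G hG) := by
  classical
  by_contra! h
  have h1 : hyperbolicityConst (MetricGraph G hG) < 1 :=
    h.trans_le (ENNReal.div_le_of_le_mul (by norm_num))
  obtain ⟨r⟩ := hG.nonempty
  have h2 := two_mul_card_edge_le hG h1 r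
  have hpos : 0 < Fintype.card V := Fintype.card_pos_iff.2 ⟨r⟩
  rw [Finset.filter_eq_empty_iff.2, Finset.card_empty] at h2
  · omega
  · rintro ⟨u, v⟩ - ⟨huv, hd⟩
    obtain ⟨a, hau, hav, -⟩ := exists_common_parent hG h1 huv hd
    exact not_lt.2 (three_quarters_le_of_triangle hG hau hav huv) h

end MetricGraph

/-! ### Graphs with a universal vertex -/

namespace MetricGraph

variable {V : Type*} [Fintype V] {G : SimpleGraph V} {hG : G.Connected}

/-- `U` is a union of connected components of the graph without the vertex `c`. -/
structure IsBranch (G : SimpleGraph V) (c : V) (U : Set V) : Prop where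
  notMem : c ∉ U
  closed : ∀ a ∈ U, ∀ b, G.Adj a b → b ∈ U ∨ b = c

/-- The points of the edges that have an endpoint in `U`, without the endpoints outside of `U`. -/
def openStar (hG : G.Connected) (U : Set V) : Set (MetricGraph G hG) :=
  {q | ∃ v ∈ U, q.coord v ≠ 0}

section Universal

variable {c : V} {U : Set V} (hc : ∀ v, v ≠ c → G.Adj c v)
include hc

theorem exists_isOn_of_mem_openStar (hU : IsBranch G c U) {q : MetricGraph G hG}
    (hq : q ∈ openStar hG U) :
    ∃ a b, G.Adj a b ∧ q.IsOn a b ∧ a ∈ U ∧ (b ∈ U ∨ b = c) := by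
  obtain ⟨v, hv, hqv⟩ := hq
  obtain ⟨a, b, hab, hs⟩ := q.supp
  have hvc : v ≠ c := by
    rintro rfl
    exact hU.notMem hv
  rcases hab with rfl | hab
  · refine ⟨v, c, (hc v hvc).symm, fun w hw => Or.inl ?_, hv, Or.inr rfl⟩
    have := hs w hw
    have := hs v hqv
    grind
  · rcases hs v hqv with rfl | rfl
    · exact ⟨v, b, hab, hs, hv, hU.closed v hv b hab⟩
    · exact ⟨v, a, hab.symm, fun w hw => (hs w hw).symm, hv, hU.closed v hv a hab.symm⟩

theorem cutsOff_openStar (hU : IsBranch G c U) : CutsOff (vtx hG c) (openStar hG U) := by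
  intro q hq r hr
  refine le_antisymm (dist_triangle _ _ _) ?_
  obtain ⟨a, b, hab, hqo, ha, hb⟩ := exists_isOn_of_mem_openStar hc hU hq
  have hrU : ∀ w, r.coord w ≠ 0 → w ∉ U := fun w hw hwU => hr ⟨w, hwU, hw⟩
  by_cases hs : SameEdge q r
  · have hrc : r = vtx hG c := by
      refine eq_vtx fun w hw => ?_
      obtain ⟨v, hv, hqv⟩ := hq
      obtain ⟨u, u', huu, h1, h2⟩ := hs
      have hwU := hrU w hw
      have hvw : v ≠ w := by
        rintro rfl
        exact hwU hv
      have hadj : G.Adj v w := by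
        rcases h1 v hqv with rfl | rfl <;> rcases h2 w hw with rfl | rfl <;>
          rcases huu with huu | huu <;>
          first
            | exact absurd rfl hvw | exact absurd huu hvw | exact absurd huu.symm hvw
            | exact huu | exact huu.symm
      exact (hU.closed v hv w hadj).resolve_left hwU
    rw [hrc, dist_self, add_zero]
  · refine le_dist_of_not_sameEdge hs fun u w hu hw => ?_
    have h1 : dist q (vtx hG c) ≤ _ := pathDist_le q (vtx hG c) hu (v := c) (by simp)
    have h2 : dist (vtx hG c) r ≤ _ := pathDist_le (vtx hG c) r (u := c) (by simp) hw
    rw [vtx_self] at h1 h2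
    have h3 : ((G.dist u c : ℕ) : ℝ) + G.dist c w ≤ G.dist u w := by
      by_cases huc : u = c
      · rw [huc]
        simp
      by_cases hwc : w = c
      · rw [hwc]
        simp
      have huU : u ∈ U := by
        rcases hqo u hu with rfl | rfl
        · exact ha
        · exact hb.resolve_right huc
      have hwU := hrU w hw
      have hne : u ≠ w := by
        rintro rfl
        exact hwU huU
      have := hG.one_lt_dist_of_ne_of_not_adj hne fun hadj =>
        (hU.closed u huU w hadj).elim hwU hwc
      rw [SimpleGraph.dist_eq_one_iff_adj.2 (hc u huc).symm,
        SimpleGraph.dist_eq_one_iff_adj.2 (hc w hwc)]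
      exact_mod_cast this
    linarith

/-- If any two edges of a branch, together with `c`, can be joined end to end by two paths of
total length at most `l`, then two points on them are at distance at most `1 + l / 2`: the two
paths and the two edges form a closed curve of length at most `2 + l`. Hence the
hyperbolicity constant is at most half of this number. -/
theorem hyperbolicityConst_le_of_universal (l : ℕ)
    (h : ∀ v, v ≠ c → ∃ U : Set V, v ∈ U ∧ IsBranch G c U ∧
      ∀ a b d e, (a ∈ U ∨ a = c) → (b ∈ U ∨ b = c) → (d ∈ U ∨ d = c) → (e ∈ U ∨ e = c) →
        G.Adj a b → G.Adj d e →
          G.dist a d + G.dist b e ≤ l ∨ G.dist a e + G.dist b d ≤ l) :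
    hyperbolicityConst (MetricGraph G hG) ≤ ENNReal.ofReal ((1 + l / 2) / 2) := by
  refine hyperbolicityConst_le_of_cutsOff (by positivity) (vtx hG c) fun p hp => ?_
  obtain ⟨v, hv, hpv⟩ : ∃ v, v ≠ c ∧ p.coord v ≠ 0 := by
    by_contra! h0
    refine hp (eq_vtx fun w hw => ?_)
    by_contra hwc
    exact hw (h0 w hwc)
  obtain ⟨U, hvU, hU, hl⟩ := h v hv
  have edges : ∀ {a b d e : V} {x y : MetricGraph G hG}, (a ∈ U ∨ a = c) → (b ∈ U ∨ b = c) →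
      (d ∈ U ∨ d = c) → (e ∈ U ∨ e = c) → G.Adj a b → G.Adj d e → x.IsOn a b → y.IsOn d e →
      dist x y ≤ 1 + l / 2 := by
    intro a b d e x y ha hb hd he hab hde hx hy
    have hx1 := x.add_eq_one hab.ne hx
    have hy1 := y.add_eq_one hde.ne hy
    rcases hl a b d e ha hb hd he hab hde with hl | hl
    · have h1 := dist_le_of_isOn hab hde hx hy
      have h2 := dist_le_of_isOn hab.symm hde.symm hx.symm hy.symm
      have h3 : (G.dist a d : ℝ) + G.dist b e ≤ l := by exact_mod_cast hl
      linarith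
    · have h1 := dist_le_of_isOn hab hde.symm hx hy.symm
      have h2 := dist_le_of_isOn hab.symm hde hx.symm hy
      have h3 : (G.dist a e : ℝ) + G.dist b d ≤ l := by exact_mod_cast hl
      linarith
  refine ⟨openStar hG U, ⟨v, hvU, hpv⟩, ?_, cutsOff_openStar hc hU, ?_, ?_⟩
  · rintro ⟨w, hw, hcw⟩
    rw [eq_of_vtx_ne_zero hcw] at hw
    exact hU.notMem hw
  · intro x hx y hy
    obtain ⟨a, b, hab, hxo, ha, hb⟩ := exists_isOn_of_mem_openStar hc hU hx
    obtain ⟨d, e, hde, hyo, hd, he⟩ := exists_isOn_of_mem_openStar hc hU hy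
    exact edges (Or.inl ha) hb (Or.inl hd) he hab hde hxo hyo
  · intro x hx
    obtain ⟨a, b, hab, hxo, ha, hb⟩ := exists_isOn_of_mem_openStar hc hU hx
    exact edges (Or.inl ha) hb (Or.inr rfl) (Or.inl hvU) hab (hc v hv) hxo (vtx_isOn_left c v)

/-- In a star every point is a cut point, so that triangles are tripods. -/
theorem hyperbolicityConst_star (hstar : ∀ a b, G.Adj a b → a = c ∨ b = c) :
    hyperbolicityConst (MetricGraph G hG) = 0 := by
  have branch : ∀ v, v ≠ c → IsBranch G c {v} := fun v hv =>
    ⟨fun h => hv h.symm, by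
      rintro a rfl b hab
      exact Or.inr ((hstar _ b hab).resolve_left hv)⟩
  have isOn : ∀ {v} (q : MetricGraph G hG), v ≠ c → q.coord v ≠ 0 → q.IsOn v c := by
    intro v q hv hq
    obtain ⟨a, b, hab, hqo, rfl, hb⟩ := exists_isOn_of_mem_openStar hc (branch v hv)
      (q := q) ⟨v, rfl, hq⟩
    rcases hb with hb | rfl
    · exact absurd hb.symm hab.ne
    · exact hqo
  -- The distance of two points on the same ray, or of a point on a ray and a point off it.
  have on_ray : ∀ {v} (q r : MetricGraph G hG), v ≠ c → q.coord v ≠ 0 → r.coord v ≠ 0 →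
      dist q r = |q.coord v - r.coord v| := fun q r hv hq hr =>
    (isOn q hv hq).dist_eq (hc _ hv).symm (isOn r hv hr)
  have to_center : ∀ {v} (q : MetricGraph G hG), v ≠ c → q.coord v ≠ 0 →
      dist q (vtx hG c) = q.coord v := by
    intro v q hv hq
    have h1 := (isOn q hv hq).symm.dist_vtx (hc v hv)
    have h2 := q.add_eq_one hv (isOn q hv hq)
    linarith
  have off_ray : ∀ {v} (q r : MetricGraph G hG), v ≠ c → q.coord v ≠ 0 → r.coord v = 0 →
      dist q r = q.coord v + dist (vtx hG c) r := by
    intro v q r hv hq hr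
    rw [cutsOff_openStar hc (branch v hv) q ⟨v, rfl, hq⟩ r, to_center q hv hq]
    rintro ⟨w, rfl, hw⟩
    exact hw hr
  have exists_ray : ∀ q : MetricGraph G hG, q ≠ vtx hG c → ∃ v, v ≠ c ∧ q.coord v ≠ 0 := by
    intro q hq
    by_contra! h0
    refine hq (eq_vtx fun w hw => ?_)
    by_contra hwc
    exact hw (h0 w hwc)
  refine hyperbolicityConst_eq_zero_of_cutsOff fun p x hxp => ?_
  by_cases hpc : p = vtx hG c
  · subst hpc
    obtain ⟨v, hv, hxv⟩ := exists_ray x hxp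
    refine ⟨openStar hG {v}, ⟨v, rfl, hxv⟩, cutsOff_openStar hc (branch v hv), ?_⟩
    rintro y ⟨w, rfl, hyv⟩
    have h1 := (x.nonneg w).lt_of_ne' hxv
    have h2 := (y.nonneg w).lt_of_ne' hyv
    rw [on_ray x y hv hxv hyv, to_center x hv hxv, dist_comm _ y, to_center y hv hyv, abs_lt]
    constructor <;> linarith
  obtain ⟨v, hv, hpv⟩ := exists_ray p hpc
  have hp0 := (p.nonneg v).lt_of_ne' hpv
  -- The point `p` separates the points above it on its ray from all other points.
  have cut : ∀ q r : MetricGraph G hG, p.coord v < q.coord v → r.coord v ≤ p.coord v →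
      dist q r = dist q p + dist p r := by
    intro q r hq hr
    have hq0 : q.coord v ≠ 0 := (hp0.trans hq).ne'
    rw [on_ray q p hv hq0 hpv, abs_of_pos (by linarith)]
    by_cases hr0 : r.coord v = 0
    · rw [off_ray q r hv hq0 hr0, off_ray p r hv hpv hr0]
      ring
    · rw [on_ray q r hv hq0 hr0, on_ray p r hv hpv hr0, abs_of_pos (by linarith),
        abs_of_nonneg (by linarith)]
      ring
  by_cases hx : p.coord v < x.coord v
  · refine ⟨{q | p.coord v < q.coord v}, hx, fun q hq r hr => cut q r hq (not_lt.1 hr), ?_⟩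
    intro y (hy : p.coord v < y.coord v)
    rw [on_ray x y hv (hp0.trans hx).ne' (hp0.trans hy).ne', on_ray x p hv (hp0.trans hx).ne' hpv,
      on_ray p y hv hpv (hp0.trans hy).ne', abs_of_pos (sub_pos.2 hx), abs_of_neg (sub_neg.2 hy),
      abs_lt]
    constructor <;> linarith
  · have lt : ∀ y : MetricGraph G hG, y.coord v ≤ p.coord v → y ≠ p → y.coord v < p.coord v := by
      intro y hy hyp
      refine lt_of_le_of_ne hy fun h => hyp ?_
      have hy0 : y.coord v ≠ 0 := by rwa [h]
      exact (isOn y hv hy0).ext (hc v hv).symm (isOn p hv hpv) h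
    -- The distance to `p` for a point below `p` or on another ray.
    have to_p : ∀ y : MetricGraph G hG, y.coord v < p.coord v →
        y.coord v ≠ 0 ∧ dist y p = p.coord v - y.coord v ∨
        y.coord v = 0 ∧ dist y p = p.coord v + dist (vtx hG c) y := by
      intro y hy
      by_cases hy0 : y.coord v = 0
      · exact Or.inr ⟨hy0, by rw [dist_comm, off_ray p y hv hpv hy0]⟩
      · exact Or.inl ⟨hy0, by rw [on_ray y p hv hy0 hpv, abs_of_neg (by linarith), neg_sub]⟩
    refine ⟨{q | q.coord v ≤ p.coord v ∧ q ≠ p}, ⟨not_lt.1 hx, hxp⟩, ?_, ?_⟩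
    · intro q hq r hr
      by_cases hrp : r = p
      · rw [hrp, dist_self, add_zero]
      · have hr' : p.coord v < r.coord v := by
          by_contra h
          exact hr ⟨not_lt.1 h, hrp⟩
        rw [dist_comm, cut r q hr' hq.1, dist_comm r, dist_comm p q, add_comm]
    · rintro y ⟨hy, hyp⟩
      have hx' := lt x (not_lt.1 hx) hxp
      have hy' := lt y hy hyp
      rw [dist_comm p y]
      have hx0 := x.nonneg v
      have hy0 := y.nonneg v
      rcases to_p x hx' with ⟨hxv, ex⟩ | ⟨hxv, ex⟩ <;>
        rcases to_p y hy' with ⟨hyv, ey⟩ | ⟨hyv, ey⟩ <;> rw [ex, ey]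
      · rw [on_ray x y hv hxv hyv, abs_lt]
        constructor <;> linarith
      · rw [off_ray x y hv hxv hyv]
        linarith
      · rw [dist_comm, off_ray y x hv hyv hxv]
        linarith
      · have := dist_triangle x (vtx hG c) y
        rw [dist_comm x (vtx hG c)] at this
        linarith

end Universal

end MetricGraph

/-! ### The extremal graphs -/

/-- A labelling of the natural numbers whose classes are `{0}`, then `k` triples, then `r` pairs,
then singletons. -/
def blockLabel (k r x : ℕ) : ℕ :=
  if x ≤ 3 * k then (x + 2) / 3 else if x ≤ 3 * k + 2 * r then k + (x - 3 * k + 1) / 2 else x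

theorem blockLabel_eq_zero {k r x : ℕ} : blockLabel k r x = 0 ↔ x = 0 := by
  unfold blockLabel
  split_ifs <;> omega

@[simp] theorem blockLabel_zero (k r : ℕ) : blockLabel k r 0 = 0 := blockLabel_eq_zero.2 rfl

/-- Without triples the classes have at most two elements. -/
theorem blockLabel_pairs {r x y z : ℕ} (hxy : blockLabel 0 r x = blockLabel 0 r y)
    (hxz : blockLabel 0 r x = blockLabel 0 r z) : x = y ∨ x = z ∨ y = z := by
  unfold blockLabel at hxy hxz
  split_ifs at hxy hxz <;> omega

theorem card_blockLabel_class {k r M x : ℕ} (h : 3 * k + 2 * r ≤ M) (hx : x ≤ M) :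
    ((Finset.range (M + 1)).filter fun y => blockLabel k r y = blockLabel k r x).card =
      1 + 2 * (if x ∈ Finset.Ioc 0 (3 * k) then 1 else 0) +
        (if x ∈ Finset.Ioc (3 * k) (3 * k + 2 * r) then 1 else 0) := by
  have key : ∀ s : Finset ℕ, (∀ y, y ∈ s ↔ y < M + 1 ∧ blockLabel k r y = blockLabel k r x) →
      ((Finset.range (M + 1)).filter fun y => blockLabel k r y = blockLabel k r x) = s := by
    intro s hs
    ext y
    simp [hs]
  by_cases h1 : x ∈ Finset.Ioc 0 (3 * k)
  · have h2 : x ∉ Finset.Ioc (3 * k) (3 * k + 2 * r) := by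
      rw [Finset.mem_Ioc] at h1 ⊢
      omega
    rw [if_pos h1, if_neg h2]
    rw [Finset.mem_Ioc] at h1
    rw [key (Finset.Icc (3 * ((x - 1) / 3) + 1) (3 * ((x - 1) / 3) + 3)), Nat.card_Icc]
    · omega
    · intro y
      rw [Finset.mem_Icc]
      unfold blockLabel
      split_ifs <;> omega
  · by_cases h2 : x ∈ Finset.Ioc (3 * k) (3 * k + 2 * r)
    · rw [if_neg h1, if_pos h2]
      rw [Finset.mem_Ioc] at h1 h2
      rw [key (Finset.Icc (3 * k + 2 * ((x - 3 * k - 1) / 2) + 1)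
        (3 * k + 2 * ((x - 3 * k - 1) / 2) + 2)), Nat.card_Icc]
      · omega
      · intro y
        rw [Finset.mem_Icc]
        unfold blockLabel
        split_ifs <;> omega
    · rw [if_neg h1, if_neg h2]
      rw [Finset.mem_Ioc] at h1 h2
      rw [key {x}, Finset.card_singleton]
      intro y
      rw [Finset.mem_singleton]
      unfold blockLabel
      split_ifs <;> omega

theorem sum_card_blockLabel_class {k r M : ℕ} (h : 3 * k + 2 * r ≤ M) :
    ∑ x ∈ Finset.range (M + 1),
      ((Finset.range (M + 1)).filter fun y => blockLabel k r y = blockLabel k r x).card =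
      M + 1 + 6 * k + 2 * r := by
  rw [Finset.sum_congr rfl fun x hx => card_blockLabel_class h
    (Nat.lt_succ_iff.1 (Finset.mem_range.1 hx))]
  rw [Finset.sum_add_distrib, Finset.sum_add_distrib, ← Finset.mul_sum, Finset.sum_ite_mem,
    Finset.sum_ite_mem, Finset.inter_eq_right.2, Finset.inter_eq_right.2]
  · simp
    omega
  · intro y
    simp only [Finset.mem_Ioc, Finset.mem_range]
    omega
  · intro y
    simp only [Finset.mem_Ioc, Finset.mem_range]
    omega

/-- Degree counting for a graph on `Fin n` whose adjacency is the restriction of a relation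
on `ℕ`. -/
theorem two_mul_ncard_edgeSet {n : ℕ} {G : SimpleGraph (Fin n)} {A : ℕ → ℕ → Prop}
    [DecidableRel A] (hA : ∀ x y : Fin n, G.Adj x y ↔ A x y) :
    2 * G.edgeSet.ncard = ∑ x ∈ Finset.range n, ((Finset.range n).filter (A x)).card := by
  classical
  rw [Set.ncard_eq_toFinset_card', ← SimpleGraph.edgeFinset,
    ← SimpleGraph.sum_degrees_eq_twice_card_edges,
    ← Fin.sum_univ_eq_sum_range fun x => ((Finset.range n).filter (A x)).card]
  refine Finset.sum_congr rfl fun x _ => ?_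
  rw [← SimpleGraph.card_neighborFinset_eq_degree, Finset.card_filter,
    ← Fin.sum_univ_eq_sum_range fun y => if A x y then 1 else 0, ← Finset.card_filter]
  congr 1
  ext y
  simp [hA]

/-- A graph on `Fin (M + 1)` in which `0` is universal is connected. -/
theorem connected_of_universal {M : ℕ} {G : SimpleGraph (Fin (M + 1))}
    (h : ∀ v, v ≠ 0 → G.Adj 0 v) : G.Connected := by
  have h0 : ∀ v, G.Reachable 0 v := fun v => by
    by_cases hv : v = 0
    · rw [hv]
    · exact (h v hv).reachable
  exact ⟨fun u v => (h0 u).symm.trans (h0 v)⟩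

/-- The windmill: `r` triangles (for `2 * r ≤ M`) and otherwise pendant edges, all with the common
vertex `0`. -/
def windmill (M r : ℕ) : SimpleGraph (Fin (M + 1)) where
  Adj x y := x.val ≠ y.val ∧
    (x.val = 0 ∨ y.val = 0 ∨ blockLabel 0 r x.val = blockLabel 0 r y.val)
  symm := ⟨fun x y h => ⟨h.1.symm, by
    rcases h.2 with h | h | h
    · exact Or.inr (Or.inl h)
    · exact Or.inl h
    · exact Or.inr (Or.inr h.symm)⟩⟩
  loopless := ⟨fun x h => h.1 rfl⟩

theorem windmill_universal (M r : ℕ) (v : Fin (M + 1)) (hv : v ≠ 0) : (windmill M r).Adj 0 v :=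
  ⟨fun h => hv (Fin.ext h.symm), Or.inl rfl⟩

theorem ncard_edgeSet_windmill {M r : ℕ} (h : 2 * r ≤ M) :
    (windmill M r).edgeSet.ncard = M + r := by
  have h1 := two_mul_ncard_edgeSet (G := windmill M r)
    (A := fun x y => x ≠ y ∧ (x = 0 ∨ y = 0 ∨ blockLabel 0 r x = blockLabel 0 r y))
    (fun _ _ => Iff.rfl)
  have h2 := sum_card_blockLabel_class (k := 0) (r := r) (M := M) (by omega)
  rw [Finset.sum_range_succ'] at h1 h2
  have e0 : ((Finset.range (M + 1)).filter fun y => 0 ≠ y ∧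
      (0 = 0 ∨ y = 0 ∨ blockLabel 0 r 0 = blockLabel 0 r y)).card = M := by
    have : ((Finset.range (M + 1)).filter fun y => 0 ≠ y ∧
      (0 = 0 ∨ y = 0 ∨ blockLabel 0 r 0 = blockLabel 0 r y)) = Finset.Ioc 0 M := by
      ext y
      simp
      omega
    rw [this, Nat.card_Ioc, Nat.sub_zero]
  have e0' : ((Finset.range (M + 1)).filter
      fun y => blockLabel 0 r y = blockLabel 0 r 0).card = 1 := by
    have : ((Finset.range (M + 1)).filter
      fun y => blockLabel 0 r y = blockLabel 0 r 0) = {0} := by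
      ext y
      simp +contextual [blockLabel_eq_zero]
    rw [this, Finset.card_singleton]
  rw [e0] at h1
  rw [e0'] at h2
  -- The neighbours of `x ≠ 0` are obtained from its class by replacing `x` with `0`.
  have e : ∀ x ∈ Finset.range M, ((Finset.range (M + 1)).filter fun y => x + 1 ≠ y ∧
      (x + 1 = 0 ∨ y = 0 ∨ blockLabel 0 r (x + 1) = blockLabel 0 r y)).card =
      ((Finset.range (M + 1)).filter
        fun y => blockLabel 0 r y = blockLabel 0 r (x + 1)).card := by
    intro x hx
    rw [Finset.mem_range] at hx
    have hx0 : blockLabel 0 r (x + 1) ≠ 0 := by simp [blockLabel_eq_zero]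
    have : ((Finset.range (M + 1)).filter fun y => x + 1 ≠ y ∧
      (x + 1 = 0 ∨ y = 0 ∨ blockLabel 0 r (x + 1) = blockLabel 0 r y)) =
      insert 0 (((Finset.range (M + 1)).filter
        fun y => blockLabel 0 r y = blockLabel 0 r (x + 1)).erase (x + 1)) := by
      ext y
      simp only [Finset.mem_filter, Finset.mem_range, Finset.mem_insert, Finset.mem_erase]
      have : y = 0 → y < M + 1 ∧ x + 1 ≠ y := by omega
      grind
    rw [this, Finset.card_insert_of_notMem, Finset.card_erase_add_one]
    · simp [hx]
    · simp [hx0.symm]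
  rw [Finset.sum_congr rfl e] at h1
  omega

/-- The complete multipartite graph on the first `N + 1` vertices with parts the classes of
`blockLabel k r`, together with pendant edges at the vertex `0`, which is a part by itself. -/
def multipartite (M N k r : ℕ) : SimpleGraph (Fin (M + 1)) where
  Adj x y := x.val ≠ y.val ∧ (x.val = 0 ∨ y.val = 0 ∨
    (x.val ≤ N ∧ y.val ≤ N ∧ blockLabel k r x.val ≠ blockLabel k r y.val))
  symm := ⟨fun x y h => ⟨h.1.symm, by
    rcases h.2 with h | h | h
    · exact Or.inr (Or.inl h)
    · exact Or.inl h
    · exact Or.inr (Or.inr ⟨h.2.1, h.1, h.2.2.symm⟩)⟩⟩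
  loopless := ⟨fun x h => h.1 rfl⟩

theorem multipartite_universal (M N k r : ℕ) (v : Fin (M + 1)) (hv : v ≠ 0) :
    (multipartite M N k r).Adj 0 v :=
  ⟨fun h => hv (Fin.ext h.symm), Or.inl rfl⟩

theorem two_mul_ncard_edgeSet_multipartite {M N k r : ℕ} (hN : N ≤ M) (h : 3 * k + 2 * r ≤ N) :
    2 * (multipartite M N k r).edgeSet.ncard + 6 * k + 2 * r + N = 2 * M + N * N := by
  have h1 := two_mul_ncard_edgeSet (G := multipartite M N k r)
    (A := fun x y => x ≠ y ∧ (x = 0 ∨ y = 0 ∨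
      (x ≤ N ∧ y ≤ N ∧ blockLabel k r x ≠ blockLabel k r y)))
    (fun _ _ => Iff.rfl)
  have h2 := sum_card_blockLabel_class h
  have hr : Finset.range (M + 1) = Finset.range (N + 1) ∪ Finset.Ioc N M := by
    ext y
    simp
    omega
  have hdis : Disjoint (Finset.range (N + 1)) (Finset.Ioc N M) := by
    rw [Finset.disjoint_left]
    intro y
    simp
    omega
  rw [show ∑ x ∈ Finset.range (M + 1), _ = ∑ x ∈ Finset.range (N + 1) ∪ Finset.Ioc N M, _ from
    Finset.sum_congr hr fun _ _ => rfl, Finset.sum_union hdis] at h1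
  rw [Finset.sum_range_succ'] at h1 h2
  have e0 : ((Finset.range (M + 1)).filter fun y => 0 ≠ y ∧ (0 = 0 ∨ y = 0 ∨
      (0 ≤ N ∧ y ≤ N ∧ blockLabel k r 0 ≠ blockLabel k r y))).card = M := by
    have : ((Finset.range (M + 1)).filter fun y => 0 ≠ y ∧ (0 = 0 ∨ y = 0 ∨
      (0 ≤ N ∧ y ≤ N ∧ blockLabel k r 0 ≠ blockLabel k r y))) = Finset.Ioc 0 M := by
      ext y
      simp
      omega
    rw [this, Nat.card_Ioc, Nat.sub_zero]
  have e0' : ((Finset.range (N + 1)).filter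
      fun y => blockLabel k r y = blockLabel k r 0).card = 1 := by
    have : ((Finset.range (N + 1)).filter
      fun y => blockLabel k r y = blockLabel k r 0) = {0} := by
      ext y
      simp +contextual [blockLabel_eq_zero]
    rw [this, Finset.card_singleton]
  have eN : ∀ x ∈ Finset.Ioc N M, ((Finset.range (M + 1)).filter fun y => x ≠ y ∧ (x = 0 ∨ y = 0 ∨
      (x ≤ N ∧ y ≤ N ∧ blockLabel k r x ≠ blockLabel k r y))).card = 1 := by
    intro x hx
    rw [Finset.mem_Ioc] at hx
    have : ((Finset.range (M + 1)).filter fun y => x ≠ y ∧ (x = 0 ∨ y = 0 ∨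
      (x ≤ N ∧ y ≤ N ∧ blockLabel k r x ≠ blockLabel k r y))) = {0} := by
      ext y
      simp only [Finset.mem_filter, Finset.mem_range, Finset.mem_singleton]
      omega
    rw [this, Finset.card_singleton]
  -- The neighbours of a vertex in `1, …, N` and its class partition `0, …, N`.
  have e : ∀ x ∈ Finset.range N, ((Finset.range (M + 1)).filter fun y => x + 1 ≠ y ∧
      (x + 1 = 0 ∨ y = 0 ∨
        (x + 1 ≤ N ∧ y ≤ N ∧ blockLabel k r (x + 1) ≠ blockLabel k r y))).card +
      ((Finset.range (N + 1)).filter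
        fun y => blockLabel k r y = blockLabel k r (x + 1)).card = N + 1 := by
    intro x hx
    rw [Finset.mem_range] at hx
    have hx0 : blockLabel k r (x + 1) ≠ 0 := by simp [blockLabel_eq_zero]
    have : ((Finset.range (M + 1)).filter fun y => x + 1 ≠ y ∧ (x + 1 = 0 ∨ y = 0 ∨
        (x + 1 ≤ N ∧ y ≤ N ∧ blockLabel k r (x + 1) ≠ blockLabel k r y))) =
      (Finset.range (N + 1)).filter fun y => ¬ blockLabel k r y = blockLabel k r (x + 1) := by
      ext y
      simp only [Finset.mem_filter, Finset.mem_range]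
      have h3 : y = 0 → blockLabel k r y = 0 := fun h => blockLabel_eq_zero.2 h
      have h4 : y = x + 1 → blockLabel k r y = blockLabel k r (x + 1) := fun h => by rw [h]
      constructor
      · rintro ⟨hy, hne, h | h | h⟩
        · omega
        · exact ⟨by omega, by rw [h3 h]; exact hx0.symm⟩
        · exact ⟨by omega, fun h' => h.2.2 h'.symm⟩
      · rintro ⟨hy, hne⟩
        exact ⟨by omega, fun h => hne (h4 h.symm), Or.inr (Or.inr ⟨by omega, by omega,
          fun h => hne h.symm⟩)⟩
    rw [this, add_comm, Finset.card_filter_add_card_filter_not, Finset.card_range]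
  rw [e0, Finset.sum_congr rfl eN, Finset.sum_const, Nat.card_Ioc, smul_eq_mul, mul_one] at h1
  rw [e0'] at h2
  have h3 := Finset.sum_congr rfl e
  rw [Finset.sum_add_distrib, Finset.sum_const, Finset.card_range, smul_eq_mul] at h3
  rw [mul_add, mul_one] at h3
  omega

/-! ### The constants of the extremal graphs -/

open MetricGraph

theorem dist_le_one_of_adj {V : Type*} {G : SimpleGraph V} {u v : V} (h : u ≠ v → G.Adj u v) :
    G.dist u v ≤ 1 := by
  by_cases huv : u = v
  · rw [huv, SimpleGraph.dist_self]
    exact zero_le_one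
  · rw [SimpleGraph.dist_eq_one_iff_adj.2 (h huv)]

/-- Without triangles the windmill is a star. -/
theorem hyperbolicityConst_windmill_zero (M : ℕ) (hG : (windmill M 0).Connected) :
    hyperbolicityConst (MetricGraph (windmill M 0) hG) = 0 := by
  refine hyperbolicityConst_star (c := 0) (windmill_universal M 0) ?_
  rintro a b ⟨hne, h | h | h⟩
  · exact Or.inl (Fin.ext h)
  · exact Or.inr (Fin.ext h)
  · unfold blockLabel at h
    split_ifs at h <;> omega

/-- The edges of each branch of a windmill, together with `0`, lie in a triangle, where two edges
share an endpoint and can be joined by paths of lengths zero and at most one. -/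
theorem hyperbolicityConst_windmill_le (M r : ℕ) (hG : (windmill M r).Connected) :
    hyperbolicityConst (MetricGraph (windmill M r) hG) ≤ 3 / 4 := by
  have h34 : (3 / 4 : ℝ≥0∞) = ENNReal.ofReal ((1 + (1 : ℕ) / 2) / 2) := by
    rw [show ((1 + ((1 : ℕ) : ℝ) / 2) / 2) = 3 / 4 by norm_num,
      ENNReal.ofReal_div_of_pos (by norm_num)]
    norm_num
  rw [h34]
  refine hyperbolicityConst_le_of_universal (c := 0) (windmill_universal M r) 1 fun v hv => ?_
  have hv0 : blockLabel 0 r v.val ≠ 0 := fun h => hv (Fin.ext (blockLabel_eq_zero.1 h))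
  refine ⟨{w | blockLabel 0 r w.val = blockLabel 0 r v.val}, rfl, ⟨?_, ?_⟩, ?_⟩
  · intro h
    have h' : blockLabel 0 r 0 = blockLabel 0 r v.val := h
    rw [blockLabel_zero] at h'
    exact hv0 h'.symm
  · rintro a (ha : blockLabel 0 r a.val = _) b ⟨-, h | h | h⟩
    · rw [h, blockLabel_zero] at ha
      exact absurd ha.symm hv0
    · exact Or.inr (Fin.ext h)
    · exact Or.inl (h.symm.trans ha)
  · intro a b d e ha hb hd he hab hde
    simp only [Set.mem_ofPred_eq] at ha hb hd he
    have near : ∀ {x y : Fin (M + 1)},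
        (blockLabel 0 r x.val = blockLabel 0 r v.val ∨ x = 0) →
        (blockLabel 0 r y.val = blockLabel 0 r v.val ∨ y = 0) →
        (windmill M r).dist x y ≤ 1 := by
      intro x y hx hy
      refine dist_le_one_of_adj fun hxy => ⟨fun h => hxy (Fin.ext h), ?_⟩
      rcases hx with hx | rfl
      · rcases hy with hy | rfl
        · exact Or.inr (Or.inr (hx.trans hy.symm))
        · exact Or.inr (Or.inl rfl)
      · exact Or.inl rfl
    have pairs : ∀ {x y z : Fin (M + 1)}, blockLabel 0 r x.val = blockLabel 0 r v.val →
        blockLabel 0 r y.val = blockLabel 0 r v.val →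
        blockLabel 0 r z.val = blockLabel 0 r v.val → x = y ∨ x = z ∨ y = z := by
      intro x y z hx hy hz
      simpa only [Fin.ext_iff] using blockLabel_pairs (hx.trans hy.symm) (hx.trans hz.symm)
    have hne1 := hab.ne
    have hne2 := hde.ne
    -- Two edges of a triangle have a common endpoint.
    have common : a = d ∨ b = e ∨ a = e ∨ b = d := by
      rcases ha with ha | ha <;> rcases hb with hb | hb <;> rcases hd with hd | hd <;>
        rcases he with he | he <;> grind
    rcases common with rfl | rfl | rfl | rfl
    · left
      rw [SimpleGraph.dist_self, zero_add]
      exact near hb he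
    · left
      rw [SimpleGraph.dist_self, add_zero]
      exact near ha hd
    · right
      rw [SimpleGraph.dist_self, zero_add]
      exact near hb hd
    · right
      rw [SimpleGraph.dist_self, add_zero]
      exact near ha he

/-- Two edges of a complete multipartite graph can be matched so that their endpoints lie in
different parts, which gives two joining paths of length at most one each. -/
theorem hyperbolicityConst_multipartite_le (M N k r : ℕ)
    (hG : (multipartite M N k r).Connected) :
    hyperbolicityConst (MetricGraph (multipartite M N k r) hG) ≤ 1 := by
  have h1 : (1 : ℝ≥0∞) = ENNReal.ofReal ((1 + (2 : ℕ) / 2) / 2) := by norm_num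
  rw [h1]
  refine hyperbolicityConst_le_of_universal (c := 0) (multipartite_universal M N k r) 2
    fun v hv => ?_
  by_cases hvN : v.val ≤ N
  · refine ⟨{w | w ≠ 0 ∧ w.val ≤ N}, ⟨hv, hvN⟩, ⟨fun h => h.1 rfl, ?_⟩, ?_⟩
    · rintro a ⟨ha0, haN⟩ b ⟨-, h | h | h⟩
      · exact absurd (Fin.ext h) ha0
      · exact Or.inr (Fin.ext h)
      · by_cases hb : b = 0
        · exact Or.inr hb
        · exact Or.inl ⟨hb, h.2.1⟩
    · intro a b d e ha hb hd he hab hde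
      have le : ∀ {x : Fin (M + 1)}, (x ∈ {w : Fin (M + 1) | w ≠ 0 ∧ w.val ≤ N} ∨ x = 0) →
          x.val ≤ N := by
        rintro x (hx | rfl)
        · exact hx.2
        · exact Nat.zero_le _
      have near : ∀ {x y : Fin (M + 1)}, x.val ≤ N → y.val ≤ N →
          blockLabel k r x.val ≠ blockLabel k r y.val →
          (multipartite M N k r).dist x y ≤ 1 := fun hx hy hxy =>
        dist_le_one_of_adj fun hne =>
          ⟨fun h => hne (Fin.ext h), Or.inr (Or.inr ⟨hx, hy, hxy⟩)⟩
      have label_ne : ∀ {x y : Fin (M + 1)}, (multipartite M N k r).Adj x y →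
          blockLabel k r x.val ≠ blockLabel k r y.val := by
        rintro x y ⟨hne, h | h | h⟩ h'
        · rw [h, blockLabel_zero] at h'
          have := blockLabel_eq_zero.1 h'.symm
          omega
        · rw [h, blockLabel_zero] at h'
          have := blockLabel_eq_zero.1 h'
          omega
        · exact h.2.2 h'
      have l1 := label_ne hab
      have l2 := label_ne hde
      have ha' := le ha
      have hb' := le hb
      have hd' := le hd
      have he' := le he
      by_cases hcase : blockLabel k r a.val = blockLabel k r d.val ∨
          blockLabel k r b.val = blockLabel k r e.val
      · -- The endpoints are then in different parts when they are matched crosswise.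
        right
        have n1 : (multipartite M N k r).dist a e ≤ 1 := near ha' he' (by
          rcases hcase with h | h
          · rwa [h]
          · rwa [← h])
        have n2 : (multipartite M N k r).dist b d ≤ 1 := near hb' hd' (by
          rcases hcase with h | h
          · rw [← h]; exact l1.symm
          · rw [h]; exact l2.symm)
        omega
      · push Not at hcase
        left
        have n1 := near ha' hd' hcase.1
        have n2 := near hb' he' hcase.2
        omega
  · refine ⟨{v}, rfl, ⟨fun h => hv h.symm, ?_⟩, ?_⟩
    · rintro a rfl b ⟨-, h | h | h⟩
      · exact absurd (Fin.ext h) hv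
      · exact Or.inr (Fin.ext h)
      · exact absurd h.1 hvN
    · intro a b d e ha hb hd he hab hde
      have hne1 := hab.ne
      have hne2 := hde.ne
      have : a = d ∧ b = e ∨ a = e ∧ b = d := by
        simp only [Set.mem_singleton_iff] at ha hb hd he
        grind
      rcases this with ⟨rfl, rfl⟩ | ⟨rfl, rfl⟩ <;> simp

/-- The parameters of a complete multipartite graph with `s` edges and parts of size at most
three: if `(N - 1).choose 2 < s ≤ N.choose 2`, then at most `N - 2` edges of the complete graph on
`N` vertices have to be removed, and they can be chosen as disjoint triangles and at most two
disjoint edges, since `3 * k + 2 * r ≤ (3 * k + r) + 2` for `r ≤ 2`. -/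
theorem exists_multipartite_parameters {s : ℕ} (hs : 1 ≤ s) {M : ℕ} (hM : s ≤ M.choose 2) :
    ∃ N k r : ℕ, N ≤ M ∧ 3 * k + 2 * r ≤ N ∧ s + 3 * k + r = N.choose 2 := by
  classical
  have hex : ∃ N : ℕ, s ≤ N.choose 2 := ⟨M, hM⟩
  have hle := Nat.find_spec hex
  have hNM := Nat.find_min' hex hM
  have hmin := fun {j} => Nat.find_min hex (m := j)
  obtain ⟨N, hN⟩ : ∃ N, N = Nat.find hex := ⟨_, rfl⟩
  rw [← hN] at hle hNM hmin
  obtain _ | N := N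
  · simp at hle
    omega
  have h1 := hmin (Nat.lt_succ_self N)
  have h2 : (N + 1).choose 2 = N + N.choose 2 := by
    rw [Nat.choose_succ_succ' N 1, Nat.choose_one_right]
  exact ⟨N + 1, ((N + 1).choose 2 - s) / 3, ((N + 1).choose 2 - s) % 3, hNM, by omega, by omega⟩

end GromovHyp

theorem theorem6 (n m : ℕ) (hn : 1 ≤ n) (hm : m ≤ n.choose 2) :
    (m = n - 1 → IsLeast (GromovHyp.hyperbolicityConstants n m) 0) ∧
    (n ≤ m → 2 * m ≤ 3 * n - 3 → IsLeast (GromovHyp.hyperbolicityConstants n m) (3 / 4)) ∧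
    (n ≤ m → 3 * n - 3 < 2 * m → IsLeast (GromovHyp.hyperbolicityConstants n m) 1) := by
  obtain ⟨M, rfl⟩ : ∃ M, n = M + 1 := ⟨n - 1, by omega⟩
  refine ⟨fun h => ⟨?_, fun _ _ => zero_le⟩, fun h1 h2 => ⟨?_, ?_⟩, fun h1 h2 => ⟨?_, ?_⟩⟩
  · refine ⟨GromovHyp.windmill M 0,
      GromovHyp.connected_of_universal (GromovHyp.windmill_universal M 0), ?_,
      (GromovHyp.hyperbolicityConst_windmill_zero M _).symm⟩
    rw [GromovHyp.ncard_edgeSet_windmill (by omega)]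
    omega
  · have hcard : (GromovHyp.windmill M (m - M)).edgeSet.ncard = m := by
      rw [GromovHyp.ncard_edgeSet_windmill (by omega)]
      omega
    have hG := GromovHyp.connected_of_universal (GromovHyp.windmill_universal M (m - M))
    refine ⟨_, hG, hcard, le_antisymm ?_ (GromovHyp.hyperbolicityConst_windmill_le M _ hG)⟩
    exact GromovHyp.MetricGraph.three_quarters_le_hyperbolicityConst hG
      (by rwa [hcard, Fintype.card_fin])
  · rintro _ ⟨G, hG, hcard, rfl⟩
    exact GromovHyp.MetricGraph.three_quarters_le_hyperbolicityConst hG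
      (by rwa [hcard, Fintype.card_fin])
  · have hch : (M + 1).choose 2 = M + M.choose 2 := by
      rw [Nat.choose_succ_succ' M 1, Nat.choose_one_right]
    obtain ⟨N, k, r, hNM, hkr, hs⟩ :=
      GromovHyp.exists_multipartite_parameters (s := m - M) (M := M) (by omega) (by omega)
    have hcard : (GromovHyp.multipartite M N k r).edgeSet.ncard = m := by
      have e1 := GromovHyp.two_mul_ncard_edgeSet_multipartite hNM hkr
      have e3 : N * N = 2 * N.choose 2 + N := by
        rw [Nat.choose_two_right, Nat.mul_div_cancel' (Nat.even_mul_pred_self N).two_dvd,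
          Nat.mul_sub, mul_one, Nat.sub_add_cancel (Nat.le_mul_self N)]
      omega
    have hG := GromovHyp.connected_of_universal (GromovHyp.multipartite_universal M N k r)
    refine ⟨_, hG, hcard, le_antisymm ?_ (GromovHyp.hyperbolicityConst_multipartite_le M N k r hG)⟩
    refine GromovHyp.MetricGraph.one_le_hyperbolicityConst hG ?_
    rw [hcard, Fintype.card_fin]
    omega
  · rintro _ ⟨G, hG, hcard, rfl⟩
    refine GromovHyp.MetricGraph.one_le_hyperbolicityConst hG ?_
    rw [hcard, Fintype.card_fin]
    omega
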